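/- All $L_1$-spaces are spaces of complex-valued functions. A real standard Gaussian sequence $(g^{\mathbb R}_n)_{n\ge1}$ on a probability space $(\Omega,\mathbb P)$ is an i.i.d. sequence of $N(0,1)$ random variables; a complex standard Gaussian sequence is $g_n=2^{-1/2}(g'_n+ig''_n)$, where the $g'_n$ and $g''_n$ $(n\ge1)$ together form an i.i.d. family of $N(0,1)$ random variables. For $z$ in the algebraic tensor product $X\otimes Y$ of two Banach spaces, let $$\|z\|_\wedge=\inf\Big\{\sum_i\|x_i\|\,\|y_i\| : z=\sum_i x_i\otimes y_i \text{ (finite sum)}\Big\},\qquad \|z\|_\vee=\sup\{|(f\otimes h)(z)| : f\in X^*,\ h\in Y^*,\ \|f\|\le1,\ \|h\|\le1\}$$ be its projective and injective norms. **Theorem.** There is a function $w:(0,1)\to(0,\infty)$ with $w(\delta)=O(\log(1/\delta))$ as $\delta\to0^+$ such that the following holds. Let $(T_1,m_1)$, $(T_2,m_2)$ be probability spaces, let $(g_n)_{n\ge1}$ be a complex standard Gaussian sequence on a probability space $(\Omega,\mathbb P)$, let $0<\delta<1$ and $N\ge0$, and let $\varphi^1_1,\dots,\varphi^1_N\in L_1(m_1)$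 and $\varphi^2_1,\dots,\varphi^2_N\in L_1(m_2)$. Assume that both families are $1$-dominated by $(g_n)$, i.e. for $j=1,2$ there is a bounded linear operator $u_j:L_1(\mathbb P)\to L_1(m_j)$ with $\|u_j\|\le1$ and $u_j(g_n)=\varphi^j_n$ for $1\le n\le N$. Then there are $t,r$ in the algebraic tensor product $L_1(m_1)\otimes L_1(m_2)$ with $$\sum_{n=1}^N\varphi^1_n\otimes\varphi^2_n=t+r,\qquad \|t\|_\wedge\le w(\delta),\qquad \|r\|_\vee\le\delta .$$ The same holds, with the same $w$, when $(g_n)$ is replaced by a real standard Gaussian sequence $(g^{\mathbb R}_n)_{n\ge1}$. -/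

import Mathlib

open MeasureTheory ProbabilityTheory Filter Topology
open scoped TensorProduct

noncomputable section

namespace SidonTensor

section TensorNorms

variable {E F : Type*} [NormedAddCommGroup E] [NormedSpace ℂ E]
  [NormedAddCommGroup F] [NormedSpace ℂ F]

/-- The costs `∑ ‖x i‖ * ‖y i‖` of the finite representations `z = ∑ x i ⊗ y i`. -/
def representationCosts (z : E ⊗[ℂ] F) : Set ℝ :=
  {c | ∃ (n : ℕ) (x : Fin n → E) (y : Fin n → F),
    z = ∑ i, x i ⊗ₜ[ℂ] y i ∧ c = ∑ i, ‖x i‖ * ‖y i‖}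

/-- The projective norm of an element of the algebraic tensor product. -/
def projectiveNorm (z : E ⊗[ℂ] F) : ℝ := sInf (representationCosts z)

/-- The values `|(f ⊗ h)(z)|` with `f`, `h` in the unit balls of the dual spaces. -/
def dualPairings (z : E ⊗[ℂ] F) : Set ℝ :=
  {c | ∃ (f : E →L[ℂ] ℂ) (h : F →L[ℂ] ℂ), ‖f‖ ≤ 1 ∧ ‖h‖ ≤ 1 ∧
    c = ‖TensorProduct.dualDistrib ℂ E F ((f : E →ₗ[ℂ] ℂ) ⊗ₜ[ℂ] (h : F →ₗ[ℂ] ℂ)) z‖}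

/-- The injective norm of an element of the algebraic tensor product. -/
def injectiveNorm (z : E ⊗[ℂ] F) : ℝ := sSup (dualPairings z)

/-- The infimum in `projectiveNorm` is over a nonempty set. -/
theorem representationCosts_nonempty (z : E ⊗[ℂ] F) : (representationCosts z).Nonempty := by
  obtain ⟨S, hS⟩ := TensorProduct.exists_finset z
  refine ⟨_, S.card, fun i => (S.equivFin.symm i).1.1, fun i => (S.equivFin.symm i).1.2, ?_, rfl⟩
  rw [hS, ← Finset.sum_coe_sort S (fun p => p.1 ⊗ₜ[ℂ] p.2)]
  exact (Equiv.sum_comp S.equivFin.symm (fun p : S => p.1.1 ⊗ₜ[ℂ] p.1.2)).symm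

/-- The supremum in `injectiveNorm` is over a bounded set. -/
theorem dualPairings_bddAbove (z : E ⊗[ℂ] F) : BddAbove (dualPairings z) := by
  obtain ⟨_, n, x, y, rfl, rfl⟩ := representationCosts_nonempty z
  refine ⟨∑ i, ‖x i‖ * ‖y i‖, ?_⟩
  rintro _ ⟨f, h, hf, hh, rfl⟩
  rw [map_sum]
  refine (norm_sum_le _ _).trans (Finset.sum_le_sum fun i _ => ?_)
  rw [TensorProduct.dualDistrib_apply]
  refine (norm_mul_le _ _).trans ?_
  exact mul_le_mul (f.le_of_opNorm_le_of_le hf le_rfl |>.trans (by simp))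
    (h.le_of_opNorm_le_of_le hh le_rfl |>.trans (by simp)) (norm_nonneg _) (norm_nonneg _)

end TensorNorms

section Gaussian

variable {Ω ι : Type*} [MeasurableSpace Ω]

/-- An i.i.d. family of real standard Gaussian random variables. -/
structure IsRealGaussianFamily (g : ι → Ω → ℝ) (P : Measure Ω) : Prop where
  hasLaw : ∀ n, HasLaw (g n) (gaussianReal 0 1) P
  indep : iIndepFun g P

/-- An i.i.d. family of complex standard Gaussian random variables:
`g n = (g' n + i g'' n) / √2`, where the `g' n` and the `g'' n` together form an i.i.d. family
of real standard Gaussian random variables. -/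
def IsComplexGaussianFamily (g : ι → Ω → ℂ) (P : Measure Ω) : Prop :=
  ∃ g' g'' : ι → Ω → ℝ,
    IsRealGaussianFamily (Sum.elim g' g'' : ι ⊕ ι → Ω → ℝ) P ∧
    ∀ n ω, g n ω = ((Real.sqrt 2)⁻¹ : ℝ) * ((g' n ω : ℂ) + Complex.I * (g'' n ω : ℂ))

theorem IsRealGaussianFamily.memLp {g : ι → Ω → ℝ} {P : Measure Ω}
    (hg : IsRealGaussianFamily g P) (n : ι) : MemLp (fun ω => (g n ω : ℂ)) 1 P := by
  have h : MemLp (id : ℝ → ℝ) 1 (P.map (g n)) := by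
    rw [(hg.hasLaw n).map_eq]
    exact_mod_cast memLp_id_gaussianReal (μ := 0) (v := 1) 1
  exact ((memLp_map_measure_iff h.aestronglyMeasurable (hg.hasLaw n).aemeasurable).1 h).ofReal

theorem IsComplexGaussianFamily.memLp {g : ι → Ω → ℂ} {P : Measure Ω}
    (hg : IsComplexGaussianFamily g P) (n : ι) : MemLp (g n) 1 P := by
  obtain ⟨g', g'', h, hn⟩ := hg
  have h1 := h.memLp (Sum.inl n)
  have h2 := h.memLp (Sum.inr n)
  rw [show g n = _ from funext (hn n)]
  exact (h1.add (h2.const_mul Complex.I)).const_mul _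

/-- The class in `L₁(P)` of the `n`-th variable of a real Gaussian family. -/
def IsRealGaussianFamily.toL1 {g : ι → Ω → ℝ} {P : Measure Ω}
    (hg : IsRealGaussianFamily g P) (n : ι) : Lp ℂ 1 P :=
  (hg.memLp n).toLp (fun ω => (g n ω : ℂ))

/-- The class in `L₁(P)` of the `n`-th variable of a complex Gaussian family. -/
def IsComplexGaussianFamily.toL1 {g : ι → Ω → ℂ} {P : Measure Ω}
    (hg : IsComplexGaussianFamily g P) (n : ι) : Lp ℂ 1 P :=
  (hg.memLp n).toLp (g n)

end Gaussian

/-- `(φ n)` is `C`-dominated by `(γ n)`: some bounded operator `L₁(P) → L₁(m)` of norm at most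
`C` maps `γ n` to `φ n` for all `n`. -/
def IsDominated {Ω T ι : Type*} [MeasurableSpace Ω] [MeasurableSpace T]
    {P : Measure Ω} {m : Measure T} (C : ℝ) (γ : ι → Lp ℂ 1 P) (φ : ι → Lp ℂ 1 m) : Prop :=
  ∃ u : Lp ℂ 1 P →L[ℂ] Lp ℂ 1 m, ‖u‖ ≤ C ∧ ∀ n, u (γ n) = φ n

end SidonTensor

end

/-! Let γ be the standard Gaussian measure on ℝ^ι. The tensor `∑ x_i ⊗ x_i` of the coordinates is
the kernel of the projection onto the first Wiener chaos of L²(γ). The Mehler operator of parameter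
ρ ∈ [-1, 1] multiplies the k-th chaos by `ρ ^ k`, and its kernel is the joint law of a ρ-correlated
Gaussian pair, a probability measure, so it has projective cost at most 1. A combination `∑ a_j
T_{ρ_j}` therefore costs at most `∑ |a_j|`. If `∑ a_j ρ_j = 1` while all other moments `∑ a_j ρ_j ^
k` are at most δ/2, it differs from the first-chaos projection by a form of size at most δ/2 on the
unit ball of L². Functionals on L¹(γ) act through functions bounded by 1, hence in that ball, so the
difference has small injective norm (`norm_sum_inner_coordL2_sub_le`).

The logarithm comes from `exists_moment_weights`. Differentiation at 0 of trigonometric polynomials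
of degree at most n is integration against a finitely supported measure of mass at most 3n. Applied
to powers of the sine, it isolates the first moment among orders 0, …, n. Taking `ρ = sin θ / 2`
makes the moments of order beyond n exponentially small, so n of order log(1/δ) suffices.

A Mehler kernel need not lie in the algebraic tensor product, so everything is averaged over the
fibers of a simple function close to the identity (`exists_decomposition_coordL1`). The
decomposition is then transported: both tensor norms decrease under tensor products of contractions.
In the complex case two different contractions are applied to the real coordinates, one per factor,
so that the sum becomes `∑ g_n ⊗ g_n` (`sum_holomorphicPart_tmul`). -/

noncomputable section

namespace SidonTensor

/-! ### Projective and injective norms under contractions -/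

section TensorNormBounds

variable {E F E' F' : Type*} [NormedAddCommGroup E] [NormedSpace ℂ E]
  [NormedAddCommGroup F] [NormedSpace ℂ F] [NormedAddCommGroup E'] [NormedSpace ℂ E']
  [NormedAddCommGroup F'] [NormedSpace ℂ F']

theorem representationCosts_bddBelow (z : E ⊗[ℂ] F) : BddBelow (representationCosts z) := by
  refine ⟨0, ?_⟩
  rintro _ ⟨n, x, y, -, rfl⟩
  positivity

theorem projectiveNorm_sum_tmul_le {κ : Type*} [Fintype κ] (x : κ → E) (y : κ → F) :
    projectiveNorm (∑ i, x i ⊗ₜ[ℂ] y i) ≤ ∑ i, ‖x i‖ * ‖y i‖ := by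
  refine csInf_le (representationCosts_bddBelow _) ⟨Fintype.card κ,
    fun i => x ((Fintype.equivFin κ).symm i), fun i => y ((Fintype.equivFin κ).symm i), ?_, ?_⟩
  · exact (Equiv.sum_comp (Fintype.equivFin κ).symm (fun i => x i ⊗ₜ[ℂ] y i)).symm
  · exact (Equiv.sum_comp (Fintype.equivFin κ).symm (fun i => ‖x i‖ * ‖y i‖)).symm

theorem projectiveNorm_map_le {u : E →L[ℂ] E'} {v : F →L[ℂ] F'} (hu : ‖u‖ ≤ 1) (hv : ‖v‖ ≤ 1)
    (z : E ⊗[ℂ] F) :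
    projectiveNorm (TensorProduct.map (u : E →ₗ[ℂ] E') (v : F →ₗ[ℂ] F') z) ≤
      projectiveNorm z := by
  refine le_csInf (representationCosts_nonempty z) ?_
  rintro _ ⟨n, x, y, rfl, rfl⟩
  simp only [map_sum, TensorProduct.map_tmul, ContinuousLinearMap.coe_coe]
  refine (projectiveNorm_sum_tmul_le _ _).trans (Finset.sum_le_sum fun i _ => ?_)
  gcongr
  · exact (u.le_of_opNorm_le hu _).trans_eq (one_mul _)
  · exact (v.le_of_opNorm_le hv _).trans_eq (one_mul _)

theorem injectiveNorm_le {z : E ⊗[ℂ] F} {c : ℝ} (h : ∀ (f : E →L[ℂ] ℂ) (h : F →L[ℂ] ℂ),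
    ‖f‖ ≤ 1 → ‖h‖ ≤ 1 →
    ‖TensorProduct.dualDistrib ℂ E F ((f : E →ₗ[ℂ] ℂ) ⊗ₜ[ℂ] (h : F →ₗ[ℂ] ℂ)) z‖ ≤ c) :
    injectiveNorm z ≤ c := by
  refine csSup_le ⟨_, 0, 0, by simp, by simp, rfl⟩ ?_
  rintro _ ⟨f, g, hf, hg, rfl⟩
  exact h f g hf hg

theorem injectiveNorm_map_le {u : E →L[ℂ] E'} {v : F →L[ℂ] F'} (hu : ‖u‖ ≤ 1) (hv : ‖v‖ ≤ 1)
    (z : E ⊗[ℂ] F) :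
    injectiveNorm (TensorProduct.map (u : E →ₗ[ℂ] E') (v : F →ₗ[ℂ] F') z) ≤
      injectiveNorm z := by
  refine injectiveNorm_le fun f g hf hg => ?_
  refine le_csSup (dualPairings_bddAbove z) ⟨f.comp u, g.comp v, ?_, ?_, ?_⟩
  · exact (f.opNorm_comp_le u).trans (mul_le_one₀ hf (norm_nonneg _) hu)
  · exact (g.opNorm_comp_le v).trans (mul_le_one₀ hg (norm_nonneg _) hv)
  · congr 1
    induction z with
    | zero => simp
    | tmul x y => simp
    | add x y hx hy => simp only [map_add, hx, hy]

theorem exists_decomposition_map {κ : Type*} [Fintype κ] {x : κ → E} {y : κ → F} {c δ : ℝ}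
    (h : ∃ t r : E ⊗[ℂ] F, ∑ i, x i ⊗ₜ[ℂ] y i = t + r ∧ projectiveNorm t ≤ c ∧
      injectiveNorm r ≤ δ)
    {u : E →L[ℂ] E'} {v : F →L[ℂ] F'} (hu : ‖u‖ ≤ 1) (hv : ‖v‖ ≤ 1) :
    ∃ t r : E' ⊗[ℂ] F', ∑ i, u (x i) ⊗ₜ[ℂ] v (y i) = t + r ∧ projectiveNorm t ≤ c ∧
      injectiveNorm r ≤ δ := by
  obtain ⟨t, r, htr, ht, hr⟩ := h
  refine ⟨TensorProduct.map (u : E →ₗ[ℂ] E') (v : F →ₗ[ℂ] F') t,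
    TensorProduct.map (u : E →ₗ[ℂ] E') (v : F →ₗ[ℂ] F') r, ?_,
    (projectiveNorm_map_le hu hv t).trans ht, (injectiveNorm_map_le hu hv r).trans hr⟩
  rw [← map_add, ← htr, map_sum]
  simp

end TensorNormBounds

/-! ### Weights isolating the first moment -/

section Moments

open Complex Finset

theorem sum_pow_zpow_of_isPrimitiveRoot {ω : ℂ} {M : ℕ} (hω : IsPrimitiveRoot ω M) (m : ℤ) :
    ∑ j ∈ range M, (ω ^ m) ^ j = if (M : ℤ) ∣ m then (M : ℂ) else 0 := by
  split_ifs with h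
  · rw [(hω.zpow_eq_one_iff_dvd m).2 h]; simp
  · have h1 : ω ^ m ≠ 1 := fun H => h ((hω.zpow_eq_one_iff_dvd m).1 H)
    have h2 := mul_geom_sum (ω ^ m) M
    have h3 : (ω ^ m) ^ M = 1 := by
      rw [← zpow_natCast, zpow_comm, zpow_natCast, hω.pow_eq_one, one_zpow]
    rw [h3, sub_self] at h2
    exact (mul_eq_zero.1 h2).resolve_left (sub_ne_zero.2 h1)

/-- The discrete Fejér weights: their Fourier transform on `ℤ / 4nℤ` is a triangle. -/
theorem exists_triangle_weights (n : ℕ) (hn : 0 < n) {ω : ℂ} (hω : IsPrimitiveRoot ω (4 * n)) :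
    ∃ β : ℕ → ℝ, (∀ j, 0 ≤ β j) ∧
      ∀ l : ℕ, l ≤ 2 * n → ∑ j ∈ range (4 * n), (β j : ℂ) * (ω ^ (-(l : ℤ))) ^ j = 2 * n - l := by
  have hω1 : ‖ω‖ = 1 := hω.norm'_eq_one (by omega)
  have hω0 : ω ≠ 0 := hω.ne_zero (by omega)
  have hM : ((4 * n : ℕ) : ℂ) ≠ 0 := by exact_mod_cast (by omega : 4 * n ≠ 0)
  refine ⟨fun j => ‖∑ p ∈ range (2 * n), (ω ^ p) ^ j‖ ^ 2 / (4 * n : ℕ), fun j => by positivity,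
    fun l hl => ?_⟩
  have hconj : (starRingEnd ℂ) ω = ω⁻¹ := by
    rw [inv_def, normSq_eq_norm_sq, hω1]; simp
  have key : ∀ j, (((‖∑ p ∈ range (2 * n), (ω ^ p) ^ j‖ ^ 2 / (4 * n : ℕ) : ℝ)) : ℂ) *
      (ω ^ (-(l : ℤ))) ^ j = (∑ p ∈ range (2 * n), ∑ q ∈ range (2 * n),
        (ω ^ ((p : ℤ) - q - l)) ^ j) / (4 * n : ℕ) := by
    intro j
    rw [ofReal_div, ofReal_pow, ← Complex.mul_conj', map_sum, sum_mul_sum, div_mul_eq_mul_div,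
      sum_mul]
    push_cast
    congr 1
    refine sum_congr rfl fun p _ => ?_
    rw [sum_mul]
    refine sum_congr rfl fun q _ => ?_
    rw [map_pow, map_pow, hconj, ← mul_pow, ← mul_pow]
    congr 1
    rw [zpow_sub₀ hω0, zpow_sub₀ hω0, zpow_neg, zpow_natCast, zpow_natCast, zpow_natCast, inv_pow]
    field_simp
  rw [sum_congr rfl fun j _ => key j, ← sum_div, sum_comm]
  have h2 : ∀ p ∈ range (2 * n), ∑ j ∈ range (4 * n), ∑ q ∈ range (2 * n),
      (ω ^ ((p : ℤ) - q - l)) ^ j =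
      ((4 * n : ℕ) : ℂ) * ∑ q ∈ range (2 * n), if p = q + l then 1 else 0 := by
    intro p hp
    rw [sum_comm, mul_sum]
    refine sum_congr rfl fun q hq => ?_
    rw [sum_pow_zpow_of_isPrimitiveRoot hω]
    have hp' := mem_range.1 hp
    have hq' := mem_range.1 hq
    -- Since `p, q < 2n` and `l ≤ 2n`, the difference lies strictly between `-4n` and `4n`; the
    -- modulus `4n` is large enough that no aliasing occurs.
    have : ((4 * n : ℕ) : ℤ) ∣ (p : ℤ) - q - l ↔ p = q + l := by
      constructor
      · rintro ⟨c, hc⟩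
        have hc0 : c = 0 := by
          push_cast at hc
          have h1 : c < 1 := by
            by_contra! h; nlinarith
          have h2 : -1 < c := by
            by_contra! h; nlinarith
          omega
        subst hc0
        omega
      · intro h; subst h; simp
    simp only [this]
    split_ifs <;> simp
  rw [sum_congr rfl h2, ← mul_sum, mul_div_cancel_left₀ _ hM, sum_comm]
  have h3 : ∀ q ∈ range (2 * n), (∑ p ∈ range (2 * n), if p = q + l then (1 : ℂ) else 0) =
      if q < 2 * n - l then 1 else 0 := by
    intro q _
    rw [sum_ite_eq']
    simp only [mem_range]
    congr 1
    simp; omega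
  rw [sum_congr rfl h3, ← sum_filter, sum_const]
  have : filter (fun q => q < 2 * n - l) (range (2 * n)) = range (2 * n - l) := by
    ext q; simp; omega
  rw [this, card_range, nsmul_eq_mul, mul_one, Nat.cast_sub hl]
  push_cast; ring

/-- Bernstein's inequality in functional form: differentiation at `0` of trigonometric polynomials
of degree at most `n` is given by a measure of finite support and mass at most `3n`. -/
theorem exists_derivative_weights (n : ℕ) (hn : 0 < n) :
    ∃ (a : ℕ → ℂ) (θ : ℕ → ℝ), ∑ j ∈ range (4 * n), ‖a j‖ ≤ 3 * n ∧
      ∀ l : ℤ, |l| ≤ n → ∑ j ∈ range (4 * n), a j * exp (I * l * θ j) = I * l := by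
  have h4 : 4 * n ≠ 0 := by omega
  set ω : ℂ := exp (2 * Real.pi * I / (4 * n : ℕ)) with hωdef
  have hω : IsPrimitiveRoot ω (4 * n) := Complex.isPrimitiveRoot_exp _ h4
  have hω0 : ω ≠ 0 := exp_ne_zero _
  have hω1 : ‖ω‖ = 1 := hω.norm'_eq_one h4
  obtain ⟨β, hβ, hsum⟩ := exists_triangle_weights n hn hω
  -- Modulating by `-n` shifts the triangle so that it equals `n + l` at each frequency `|l| ≤ n`; a
  -- point mass `n` at 0 removes the constant. The masses are `2n` and `n`.
  refine ⟨fun j => I * (β j * (ω ^ (-(n : ℤ))) ^ j - if j = 0 then (n : ℂ) else 0),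
    fun j => 2 * Real.pi / (4 * n : ℕ) * j, ?_, fun l hl => ?_⟩
  · have h0 := hsum 0 (by omega)
    have h0' : ∑ j ∈ range (4 * n), β j = 2 * n := by
      have : ((∑ j ∈ range (4 * n), β j : ℝ) : ℂ) = ((2 * n : ℝ) : ℂ) := by
        push_cast
        simpa using h0
      exact_mod_cast this
    calc _ ≤ ∑ j ∈ range (4 * n), (β j + if j = 0 then (n : ℝ) else 0) := by
          refine sum_le_sum fun j _ => ?_
          rw [norm_mul, norm_I, one_mul]
          refine (norm_sub_le _ _).trans (add_le_add ?_ ?_)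
          · simp [hω1, abs_of_nonneg (hβ j)]
          · split_ifs <;> simp
      _ = 3 * n := by
          rw [sum_add_distrib, h0', sum_ite_eq', if_pos (by simp; omega)]
          ring
  · rw [abs_le] at hl
    obtain ⟨m, hm⟩ : ∃ m : ℕ, (m : ℤ) = n - l := ⟨(n - l).toNat, by omega⟩
    have hexp : ∀ j : ℕ, exp (I * l * ((2 * Real.pi / (4 * n : ℕ) * j : ℝ) : ℂ)) =
        (ω ^ l) ^ j := by
      intro j
      rw [hωdef, ← exp_int_mul, ← exp_nat_mul]
      congr 1
      push_cast
      ring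
    have hl' : (l : ℂ) = n - m := by
      have : l = n - m := by omega
      rw [this]; push_cast; ring
    calc _ = ∑ j ∈ range (4 * n), (I * (β j * (ω ^ (-(m : ℤ))) ^ j) -
            if j = 0 then I * (n : ℂ) else 0) := by
          refine sum_congr rfl fun j _ => ?_
          rw [hexp, hm, neg_sub, sub_eq_add_neg l, zpow_add₀ hω0, mul_pow]
          by_cases h : j = 0
          · subst h; simp; ring
          · simp only [if_neg h]; ring
      _ = I * l := by
          rw [sum_sub_distrib, ← mul_sum, hsum m (by omega), sum_ite_eq',
            if_pos (by simp; omega), hl']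
          ring

theorem sin_pow_eq_sum_exp (k : ℕ) (x : ℝ) :
    ((Real.sin x : ℝ) : ℂ) ^ k = ∑ m ∈ range (k + 1),
      ((-1) ^ (k - m) * (k.choose m) / (2 * I) ^ k) * exp (I * ((2 * m - k : ℤ) : ℂ) * x) := by
  have h1 : ((Real.sin x : ℝ) : ℂ) = (exp (I * x) + -exp (-(I * x))) / (2 * I) := by
    rw [ofReal_sin, Complex.sin, mul_comm I, ← neg_mul]
    field_simp
    ring_nf
    simp
  rw [h1, div_pow, add_pow, sum_div]
  refine sum_congr rfl fun m hm => ?_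
  have hmk : m ≤ k := by simpa [Nat.lt_succ_iff] using hm
  rw [neg_pow, ← exp_nat_mul, ← exp_nat_mul]
  have : exp (I * ((2 * m - k : ℤ) : ℂ) * x) =
      exp (m * (I * x)) * exp ((k - m : ℕ) * (-(I * x))) := by
    rw [← exp_add]
    congr 1
    rw [Nat.cast_sub hmk]
    push_cast; ring
  rw [this]
  ring

/-- The power `sin ^ k` is a trigonometric polynomial of degree k ≤ n, so the weights compute its
derivative at 0, which vanishes unless k = 1. -/
theorem sum_weights_sin_pow {n : ℕ} {a : ℕ → ℂ} {θ : ℕ → ℝ} {s : Finset ℕ}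
    (h : ∀ l : ℤ, |l| ≤ n → ∑ j ∈ s, a j * exp (I * l * θ j) = I * l) {k : ℕ} (hk : k ≤ n) :
    ∑ j ∈ s, a j * ((Real.sin (θ j) : ℝ) : ℂ) ^ k = if k = 1 then 1 else 0 := by
  set c : ℕ → ℂ := fun m => (-1) ^ (k - m) * (k.choose m) / (2 * I) ^ k with hc
  have h1 : ∑ j ∈ s, a j * ((Real.sin (θ j) : ℝ) : ℂ) ^ k =
      ∑ m ∈ range (k + 1), c m * (I * ((2 * m - k : ℤ) : ℂ)) := by
    simp_rw [sin_pow_eq_sum_exp, mul_sum]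
    rw [sum_comm]
    refine sum_congr rfl fun m hm => ?_
    have hmk : m ≤ k := by simpa [Nat.lt_succ_iff] using hm
    have h0 := h (2 * m - k) (by rw [abs_le]; omega)
    calc _ = c m * ∑ j ∈ s, a j * exp (I * ((2 * m - k : ℤ) : ℂ) * θ j) := by
          rw [mul_sum]
          exact sum_congr rfl fun j _ => by simp only [hc]; ring
      _ = _ := by rw [h0]
  have h2 : HasDerivAt (fun x : ℝ => ((Real.sin x : ℝ) : ℂ) ^ k)
      (∑ m ∈ range (k + 1), c m * (I * ((2 * m - k : ℤ) : ℂ))) 0 := by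
    simp_rw [sin_pow_eq_sum_exp]
    refine HasDerivAt.fun_sum fun m _ => HasDerivAt.const_mul _ ?_
    have h3 : HasDerivAt (fun x : ℝ => I * ((2 * m - k : ℤ) : ℂ) * (x : ℂ))
        (I * ((2 * m - k : ℤ) : ℂ) * 1) 0 :=
      (Complex.ofRealCLM.hasDerivAt (x := 0)).const_mul _
    simpa using h3.cexp
  have h4 : HasDerivAt (fun x : ℝ => ((Real.sin x : ℝ) : ℂ) ^ k)
      (k * ((Real.sin 0 : ℝ) : ℂ) ^ (k - 1) * ((Real.cos 0 : ℝ) : ℂ)) 0 :=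
    (Real.hasDerivAt_sin 0).ofReal_comp.pow k
  rw [h1, h2.unique h4]
  rcases k with _ | _ | k <;> simp

/-- Halving the sine damps the k-th moment by `2 ^ (-k)`; doubling the weights restores the first
moment. -/
theorem exists_moment_weights_of_nat (n : ℕ) (hn : 0 < n) :
    ∃ (a : ℕ → ℂ) (ρ : ℕ → ℝ), (∀ j, |ρ j| ≤ 1) ∧
      ∑ j ∈ range (4 * n), ‖a j‖ ≤ 6 * n ∧
      ∑ j ∈ range (4 * n), a j * (ρ j : ℂ) = 1 ∧
      ∀ k ≠ 1, ‖∑ j ∈ range (4 * n), a j * (ρ j : ℂ) ^ k‖ ≤ 3 * n / 2 ^ n := by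
  obtain ⟨a, θ, ha, hder⟩ := exists_derivative_weights n hn
  have hmom : ∀ k : ℕ, ∑ j ∈ range (4 * n), (2 * a j) * ((Real.sin (θ j) / 2 : ℝ) : ℂ) ^ k =
      2 / 2 ^ k * ∑ j ∈ range (4 * n), a j * ((Real.sin (θ j) : ℝ) : ℂ) ^ k := by
    intro k
    rw [mul_sum]
    refine sum_congr rfl fun j _ => ?_
    push_cast
    rw [div_pow]
    ring
  refine ⟨fun j => 2 * a j, fun j => Real.sin (θ j) / 2, fun j => ?_, ?_, ?_, fun k hk => ?_⟩
  · rw [abs_div, abs_two]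
    have := Real.abs_sin_le_one (θ j)
    linarith
  · simp_rw [norm_mul, ← mul_sum]
    simp only [Complex.norm_ofNat]
    linarith
  · have := hmom 1
    simp only [pow_one] at this
    have h1 := sum_weights_sin_pow hder (k := 1) hn
    simp only [pow_one, if_true] at h1
    rw [this, h1]; norm_num
  · rw [hmom]
    by_cases hkn : k ≤ n
    · rw [sum_weights_sin_pow hder hkn, if_neg hk, mul_zero, norm_zero]
      positivity
    · have hb : ‖∑ j ∈ range (4 * n), a j * ((Real.sin (θ j) : ℝ) : ℂ) ^ k‖ ≤ 3 * n := by
        refine (norm_sum_le _ _).trans ((sum_le_sum fun j _ => ?_).trans ha)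
        rw [norm_mul, norm_pow, norm_real]
        exact mul_le_of_le_one_right (norm_nonneg _)
          (pow_le_one₀ (norm_nonneg _) (Real.abs_sin_le_one _))
      rw [norm_mul]
      have h2 : ‖(2 / 2 ^ k : ℂ)‖ ≤ 1 / 2 ^ n := by
        rw [norm_div, norm_pow, Complex.norm_ofNat, div_le_div_iff₀ (by positivity) (by positivity)]
        -- Here `k > n` strictly, and the extra power of 2 absorbs the doubling of the weights.
        have : (2 : ℝ) ^ (n + 1) ≤ 2 ^ k := pow_le_pow_right₀ (by norm_num) (by omega)
        rw [pow_succ] at this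
        linarith
      calc _ ≤ 1 / 2 ^ n * (3 * n : ℝ) := mul_le_mul h2 hb (norm_nonneg _) (by positivity)
        _ = _ := by ring

/-- The mass needed to isolate the first moment up to an error `δ`. -/
def massBound (δ : ℝ) : ℝ := 12 * (⌈2 * Real.log (1 / δ)⌉₊ + 4)

theorem massBound_pos (δ : ℝ) : 0 < massBound δ := by unfold massBound; positivity

theorem massBound_isBigO : massBound =O[𝓝[>] (0 : ℝ)] fun δ => Real.log (1 / δ) := by
  -- With `L = log (1 / δ) ≥ 1`, the mass is at most `12 (2L + 5) ≤ 84 L`.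
  refine Asymptotics.IsBigO.of_bound 84 ?_
  have hev : ∀ᶠ δ : ℝ in 𝓝[>] (0 : ℝ), δ ∈ Set.Ioo (0 : ℝ) (Real.exp (-1)) :=
    Ioo_mem_nhdsGT (Real.exp_pos _)
  filter_upwards [hev] with δ hδ
  have hL : 1 ≤ Real.log (1 / δ) := by
    rw [one_div, Real.log_inv]
    have := Real.log_lt_log hδ.1 hδ.2
    rw [Real.log_exp] at this
    linarith
  have hc : (⌈2 * Real.log (1 / δ)⌉₊ : ℝ) < 2 * Real.log (1 / δ) + 1 :=
    Nat.ceil_lt_add_one (by linarith)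
  rw [Real.norm_of_nonneg (massBound_pos δ).le, Real.norm_of_nonneg (by linarith)]
  unfold massBound
  linarith

theorem exists_moment_weights {δ : ℝ} (h0 : 0 < δ) (h1 : δ < 1) :
    ∃ (s : Finset ℕ) (a : ℕ → ℂ) (ρ : ℕ → ℝ), (∀ j, |ρ j| ≤ 1) ∧
      ∑ j ∈ s, ‖a j‖ ≤ massBound δ ∧
      ∑ j ∈ s, a j * (ρ j : ℂ) = 1 ∧
      ∀ k ≠ 1, ‖∑ j ∈ s, a j * (ρ j : ℂ) ^ k‖ ≤ δ / 2 := by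
  -- As `2 log 2 > 1`, this gives `2 ^ p ≥ 16 / δ`. With `n = 2p` the mass is `12 p` and the error
  -- `6p / 4 ^ p ≤ 6 / 2 ^ p` is below δ/2.
  set p : ℕ := ⌈2 * Real.log (1 / δ)⌉₊ + 4 with hp
  obtain ⟨a, ρ, hρ, hmass, hm1, hmk⟩ := exists_moment_weights_of_nat (2 * p) (by omega)
  refine ⟨_, a, ρ, hρ, hmass.trans (by unfold massBound; rw [hp]; push_cast; linarith), hm1,
    fun k hk => (hmk k hk).trans ?_⟩
  have hL : 0 ≤ Real.log (1 / δ) := Real.log_nonneg (by rw [le_div_iff₀ h0]; linarith)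
  have hpow : 16 / δ ≤ 2 ^ p := by
    have e1 : 1 / δ = Real.exp (Real.log (1 / δ)) := (Real.exp_log (by positivity)).symm
    have e2 : Real.exp (Real.log (1 / δ)) ≤ 2 ^ (⌈2 * Real.log (1 / δ)⌉₊) := by
      rw [← Real.rpow_natCast, Real.rpow_def_of_pos (by norm_num)]
      apply Real.exp_le_exp.2
      have hc := Nat.le_ceil (2 * Real.log (1 / δ))
      have hl2 := Real.log_two_gt_d9
      nlinarith
    rw [← e1] at e2
    have : 16 / δ = 1 / δ * 2 ^ 4 := by ring
    rw [hp, pow_add, this]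
    exact mul_le_mul_of_nonneg_right e2 (by norm_num)
  have hpp : (p : ℝ) ≤ 2 ^ p := by exact_mod_cast (Nat.lt_two_pow_self (n := p)).le
  have h2p : (0 : ℝ) < 2 ^ p := by positivity
  rw [pow_mul', sq, div_le_div_iff₀ (by positivity) (by norm_num)]
  rw [div_le_iff₀ h0] at hpow
  push_cast
  nlinarith

end Moments

/-! ### Density of characters in L² -/

section Characters

open Complex
open scoped RealInnerProductSpace ComplexConjugate BoundedContinuousFunction InnerProductSpace

variable {E : Type*} [NormedAddCommGroup E] [InnerProductSpace ℝ E]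
  [MeasurableSpace E] [BorelSpace E] {μ : Measure E}

variable (μ) in
/-- The character `x ↦ exp (i ⟪x, t⟫)` as an element of `L²(μ)`. -/
def charL2 [IsFiniteMeasure μ] (t : E) : Lp ℂ 2 μ :=
  BoundedContinuousFunction.toLp 2 μ ℂ (BoundedContinuousFunction.innerProbChar t)

theorem coeFn_charL2 [IsFiniteMeasure μ] (t : E) :
    charL2 μ t =ᵐ[μ] BoundedContinuousFunction.innerProbChar t :=
  BoundedContinuousFunction.coeFn_toLp _ _ _ _

variable [CompleteSpace E] [SecondCountableTopology E]

/-- The positive and negative parts of f are densities of two finite measures with the same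
characteristic function, so they agree almost everywhere. -/
theorem ae_eq_zero_of_integral_innerProbChar_real {f : E → ℝ} (hf : Integrable f μ)
    (h : ∀ t : E, ∫ x, (f x : ℂ) * BoundedContinuousFunction.innerProbChar t x ∂μ = 0) :
    f =ᵐ[μ] 0 := by
  have hfin : ∀ {g : E → ℝ}, Integrable g μ →
      IsFiniteMeasure (μ.withDensity fun x => ENNReal.ofReal (g x)) := fun hg =>
    isFiniteMeasure_withDensity_ofReal hg.2
  have hchar : ∀ {g : E → ℝ}, Integrable g μ → ∀ t : E,
      charFun (μ.withDensity fun x => ENNReal.ofReal (g x)) t =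
        ∫ x, ((max (g x) 0 : ℝ) : ℂ) * BoundedContinuousFunction.innerProbChar t x ∂μ := by
    intro g hg t
    rw [charFun_eq_integral_innerProbChar, integral_withDensity_eq_integral_toReal_smul₀
      hg.aemeasurable.ennreal_ofReal (by simp)]
    refine integral_congr_ae (Eventually.of_forall fun x => ?_)
    simp [ENNReal.toReal_ofReal']
  have h_int : ∀ {g : E → ℝ}, Integrable g μ → ∀ t : E,
      Integrable (fun x => (g x : ℂ) * BoundedContinuousFunction.innerProbChar t x) μ := by
    intro g hg t
    refine hg.ofReal.mul_bdd (c := 1)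
      (BoundedContinuousFunction.innerProbChar t).continuous.aestronglyMeasurable
      (Eventually.of_forall fun x => ?_)
    rw [BoundedContinuousFunction.innerProbChar_apply, norm_exp_ofReal_mul_I]
  have := hfin hf
  have := hfin hf.neg
  have heq : (μ.withDensity fun x => ENNReal.ofReal (f x)) =
      μ.withDensity fun x => ENNReal.ofReal ((-f) x) := by
    refine Measure.ext_of_charFun ?_
    ext t
    rw [hchar hf, hchar hf.neg, ← sub_eq_zero, ← integral_sub (h_int hf.pos_part t)
      (h_int hf.neg.pos_part t), ← h t]
    refine integral_congr_ae (Eventually.of_forall fun x => ?_)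
    simp only
    rw [← sub_mul, ← ofReal_sub]
    congr 2
    rcases le_total (f x) 0 with hx | hx <;> simp [hx]
  have hae := (withDensity_eq_iff hf.aemeasurable.ennreal_ofReal
    hf.neg.aemeasurable.ennreal_ofReal
    (by simpa using (hfin hf).measure_univ_lt_top.ne)).1 heq
  filter_upwards [hae] with x hx
  simp only [Pi.neg_apply, Pi.zero_apply] at hx ⊢
  rcases le_total (f x) 0 with h0 | h0
  · rw [ENNReal.ofReal_of_nonpos h0] at hx
    have := ENNReal.ofReal_eq_zero.1 hx.symm
    linarith
  · rw [ENNReal.ofReal_of_nonpos (neg_nonpos.2 h0)] at hx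
    have := ENNReal.ofReal_eq_zero.1 hx
    linarith

theorem ae_eq_zero_of_integral_innerProbChar {f : E → ℂ} (hf : Integrable f μ)
    (h : ∀ t : E, ∫ x, f x * BoundedContinuousFunction.innerProbChar t x ∂μ = 0) :
    f =ᵐ[μ] 0 := by
  have hbdd : ∀ {g : E → ℂ}, Integrable g μ → ∀ t : E,
      Integrable (fun x => g x * BoundedContinuousFunction.innerProbChar t x) μ := by
    intro g hg t
    refine hg.mul_bdd (c := 1)
      (BoundedContinuousFunction.innerProbChar t).continuous.aestronglyMeasurable
      (Eventually.of_forall fun x => ?_)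
    rw [BoundedContinuousFunction.innerProbChar_apply, norm_exp_ofReal_mul_I]
  have hconj : ∀ t x : E, conj (BoundedContinuousFunction.innerProbChar (-t) x) =
      BoundedContinuousFunction.innerProbChar t x := by
    intro t x
    simp [BoundedContinuousFunction.innerProbChar_apply, ← exp_conj]
  have h' : ∀ t : E, ∫ x, conj (f x) * BoundedContinuousFunction.innerProbChar t x ∂μ = 0 := by
    intro t
    rw [← map_zero conj, ← h (-t), ← integral_conj]
    simp only [map_mul, hconj]
  have hfc : Integrable (fun x => conj (f x)) μ := by
    simpa using (LinearIsometryEquiv.integrable_comp_iff (conjLIE)).2 hf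
  have hre := ae_eq_zero_of_integral_innerProbChar_real (f := fun x => (f x).re) hf.re fun t => by
    have : ∀ x, ((f x).re : ℂ) * BoundedContinuousFunction.innerProbChar t x =
        (f x * BoundedContinuousFunction.innerProbChar t x +
          conj (f x) * BoundedContinuousFunction.innerProbChar t x) / 2 := fun x => by
      rw [re_eq_add_conj]; ring
    simp_rw [this]
    rw [integral_div, integral_add (hbdd hf t) (hbdd hfc t), h, h']
    simp
  have him := ae_eq_zero_of_integral_innerProbChar_real (f := fun x => (f x).im) hf.im fun t => by
    have : ∀ x, ((f x).im : ℂ) * BoundedContinuousFunction.innerProbChar t x =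
        (f x * BoundedContinuousFunction.innerProbChar t x -
          conj (f x) * BoundedContinuousFunction.innerProbChar t x) / (2 * I) := fun x => by
      rw [im_eq_sub_conj]; ring
    simp_rw [this]
    rw [integral_div, integral_sub (hbdd hf t) (hbdd hfc t), h, h']
    simp
  filter_upwards [hre, him] with x h1 h2
  exact Complex.ext h1 h2

theorem dense_span_charL2 [IsFiniteMeasure μ] :
    Dense (Submodule.span ℂ (Set.range (charL2 μ)) : Set (Lp ℂ 2 μ)) := by
  rw [Submodule.dense_iff_topologicalClosure_eq_top, Submodule.topologicalClosure_eq_top_iff,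
    Submodule.eq_bot_iff]
  intro f hf
  rw [Submodule.mem_orthogonal] at hf
  have hfi : Integrable f μ := (Lp.memLp f).integrable (by norm_num)
  rw [Lp.eq_zero_iff_ae_eq_zero]
  refine ae_eq_zero_of_integral_innerProbChar hfi fun t => ?_
  -- The inner product conjugates its first argument, hence the sign.
  rw [← hf (charL2 μ (-t)) (Submodule.subset_span ⟨-t, rfl⟩), L2.inner_def]
  refine integral_congr_ae ?_
  filter_upwards [coeFn_charL2 (μ := μ) (-t)] with x hx
  rw [hx, RCLike.inner_apply]
  simp [BoundedContinuousFunction.innerProbChar_apply, ← exp_conj]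

end Characters

/-! ### Correlated Gaussian pairs and the Mehler form -/

section Mehler

open Complex
open scoped RealInnerProductSpace ComplexConjugate BoundedContinuousFunction InnerProductSpace

variable {E : Type*} [NormedAddCommGroup E] [InnerProductSpace ℝ E] [FiniteDimensional ℝ E]
  [MeasurableSpace E] [BorelSpace E]

/-- The second component of a pair of standard Gaussian vectors with correlation `ρ`. -/
def correlated (ρ : ℝ) (z : E × E) : E := ρ • z.1 + Real.sqrt (1 - ρ ^ 2) • z.2

theorem measurable_correlated (ρ : ℝ) : Measurable (correlated ρ : E × E → E) := by
  unfold correlated; fun_prop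

theorem integral_exp_mul_exp_prod (s t : E) :
    ∫ z : E × E, exp (⟪z.1, s⟫ * I) * exp (⟪z.2, t⟫ * I) ∂((stdGaussian E).prod (stdGaussian E)) =
      exp (-‖s‖ ^ 2 / 2) * exp (-‖t‖ ^ 2 / 2) := by
  rw [integral_prod_mul (fun x : E => exp (⟪x, s⟫ * I)) (fun x : E => exp (⟪x, t⟫ * I)),
    ← charFun_apply, ← charFun_apply, charFun_stdGaussian, charFun_stdGaussian]

theorem sq_sqrt_one_sub_sq {ρ : ℝ} (hρ : |ρ| ≤ 1) : Real.sqrt (1 - ρ ^ 2) ^ 2 = 1 - ρ ^ 2 :=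
  Real.sq_sqrt (by have := (sq_le_one_iff_abs_le_one ρ).2 hρ; linarith)

theorem measurePreserving_correlated {ρ : ℝ} (hρ : |ρ| ≤ 1) :
    MeasurePreserving (correlated ρ : E × E → E) ((stdGaussian E).prod (stdGaussian E))
      (stdGaussian E) := by
  refine ⟨measurable_correlated ρ, ?_⟩
  have := Measure.isProbabilityMeasure_map (μ := (stdGaussian E).prod (stdGaussian E))
    (measurable_correlated (E := E) ρ).aemeasurable
  refine Measure.ext_of_charFun ?_
  ext t
  rw [charFun_apply, integral_map (measurable_correlated ρ).aemeasurable
    (by fun_prop), charFun_stdGaussian]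
  have : ∀ z : E × E, exp (⟪correlated ρ z, t⟫ * I) =
      exp (⟪z.1, ρ • t⟫ * I) * exp (⟪z.2, Real.sqrt (1 - ρ ^ 2) • t⟫ * I) := by
    intro z
    rw [← exp_add, correlated, inner_add_left, real_inner_smul_left, real_inner_smul_left,
      real_inner_smul_right, real_inner_smul_right]
    push_cast
    ring_nf
  simp_rw [this]
  rw [integral_exp_mul_exp_prod, ← exp_add, norm_smul, norm_smul]
  congr 1
  norm_cast
  rw [mul_pow, mul_pow, Real.norm_eq_abs, Real.norm_eq_abs, sq_abs, sq_abs, sq_sqrt_one_sub_sq hρ]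
  ring

/-- Composition with the first coordinate, from `L²(γ)` to `L²(γ ⊗ γ)`. -/
def fstL2 : Lp ℂ 2 (stdGaussian E) →ₗᵢ[ℂ] Lp ℂ 2 ((stdGaussian E).prod (stdGaussian E)) :=
  Lp.compMeasurePreservingₗᵢ ℂ Prod.fst measurePreserving_fst

/-- Composition with the `ρ`-correlated coordinate, from `L²(γ)` to `L²(γ ⊗ γ)`. -/
def correlatedL2 {ρ : ℝ} (hρ : |ρ| ≤ 1) :
    Lp ℂ 2 (stdGaussian E) →ₗᵢ[ℂ] Lp ℂ 2 ((stdGaussian E).prod (stdGaussian E)) :=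
  Lp.compMeasurePreservingₗᵢ ℂ (correlated ρ) (measurePreserving_correlated hρ)

theorem inner_charL2 (s t : E) :
    ⟪charL2 (stdGaussian E) s, charL2 (stdGaussian E) t⟫_ℂ =
      exp (-‖s‖ ^ 2 / 2) * exp (-‖t‖ ^ 2 / 2) * exp ⟪s, t⟫ := by
  rw [L2.inner_def]
  have : ∫ x, ⟪charL2 (stdGaussian E) s x, charL2 (stdGaussian E) t x⟫_ℂ ∂(stdGaussian E) =
      charFun (stdGaussian E) (t - s) := by
    rw [charFun_apply]
    refine integral_congr_ae ?_
    filter_upwards [coeFn_charL2 (μ := stdGaussian E) s, coeFn_charL2 (μ := stdGaussian E) t]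
      with x hs ht
    rw [hs, ht, RCLike.inner_apply, BoundedContinuousFunction.innerProbChar_apply,
      BoundedContinuousFunction.innerProbChar_apply, ← exp_conj, ← exp_add, inner_sub_right]
    simp
    ring_nf
  rw [this, charFun_stdGaussian, ← exp_add, ← exp_add]
  congr 1
  norm_cast
  rw [norm_sub_sq_real, real_inner_comm]
  ring

/-- Compared with `inner_charL2`, only `⟪s, t⟫` is scaled by ρ: expanding the last exponential, the
term of degree k acquires the factor `ρ ^ k`. -/
theorem inner_fstL2_correlatedL2_charL2 {ρ : ℝ} (hρ : |ρ| ≤ 1) (s t : E) :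
    ⟪fstL2 (charL2 (stdGaussian E) s), correlatedL2 hρ (charL2 (stdGaussian E) t)⟫_ℂ =
      exp (-‖s‖ ^ 2 / 2) * exp (-‖t‖ ^ 2 / 2) * exp (ρ * ⟪s, t⟫) := by
  rw [L2.inner_def]
  have h1 : (fstL2 (charL2 (stdGaussian E) s) : E × E → ℂ)
      =ᵐ[(stdGaussian E).prod (stdGaussian E)]
      fun z => BoundedContinuousFunction.innerProbChar s z.1 :=
    (Lp.coeFn_compMeasurePreserving _ _).trans
      (measurePreserving_fst.quasiMeasurePreserving.ae_eq_comp (coeFn_charL2 s))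
  have h2 : (correlatedL2 hρ (charL2 (stdGaussian E) t) : E × E → ℂ)
      =ᵐ[(stdGaussian E).prod (stdGaussian E)]
      fun z => BoundedContinuousFunction.innerProbChar t (correlated ρ z) :=
    (Lp.coeFn_compMeasurePreserving _ _).trans
      ((measurePreserving_correlated hρ).quasiMeasurePreserving.ae_eq_comp (coeFn_charL2 t))
  have : ∫ z, ⟪fstL2 (charL2 (stdGaussian E) s) z,
      correlatedL2 hρ (charL2 (stdGaussian E) t) z⟫_ℂ ∂((stdGaussian E).prod (stdGaussian E)) =
      ∫ z : E × E, exp (⟪z.1, ρ • t - s⟫ * I) * exp (⟪z.2, Real.sqrt (1 - ρ ^ 2) • t⟫ * I)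
        ∂((stdGaussian E).prod (stdGaussian E)) := by
    refine integral_congr_ae ?_
    filter_upwards [h1, h2] with z h1 h2
    rw [h1, h2, RCLike.inner_apply, BoundedContinuousFunction.innerProbChar_apply,
      BoundedContinuousFunction.innerProbChar_apply, ← exp_conj, ← exp_add, ← exp_add,
      inner_sub_right, correlated, inner_add_left, real_inner_smul_left, real_inner_smul_left,
      real_inner_smul_right, real_inner_smul_right]
    simp
    ring_nf
  rw [this, integral_exp_mul_exp_prod, ← exp_add, ← exp_add, ← exp_add]
  congr 1
  norm_cast
  rw [norm_sub_sq_real, norm_smul, norm_smul, mul_pow, mul_pow, Real.norm_eq_abs,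
    Real.norm_eq_abs, sq_abs, sq_abs, sq_sqrt_one_sub_sq hρ, real_inner_smul_left, real_inner_comm]
  ring

/-- Obtained by differentiating the Gaussian characteristic function at t in the direction v, under
the integral sign. -/
theorem integral_inner_mul_exp_stdGaussian (v t : E) :
    ∫ x, ((⟪x, v⟫ : ℝ) : ℂ) * exp (⟪x, t⟫ * I) ∂(stdGaussian E) =
      I * ⟪v, t⟫ * exp (-‖t‖ ^ 2 / 2) := by
  have h_int : Integrable (fun x : E => (⟪x, v⟫ : ℝ)) (stdGaussian E) :=
    (IsGaussian.integrable_id (μ := stdGaussian E)).inner_const v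
  have h1 : HasDerivAt (fun τ : ℝ => ∫ x, exp (⟪x, t + τ • v⟫ * I) ∂(stdGaussian E))
      (∫ x, exp (⟪x, t + (0 : ℝ) • v⟫ * I) * (⟪x, v⟫ * I) ∂(stdGaussian E)) 0 := by
    refine (hasDerivAt_integral_of_dominated_loc_of_deriv_le (Metric.ball_mem_nhds 0 one_pos)
      (F' := fun τ x => exp (⟪x, t + τ • v⟫ * I) * (⟪x, v⟫ * I))
      (bound := fun x => |⟪x, v⟫|) ?_ ?_ ?_ ?_ h_int.abs ?_).2
    · exact Eventually.of_forall fun τ => by fun_prop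
    · refine (integrable_const (1 : ℝ)).mono' (by fun_prop) (Eventually.of_forall fun x => ?_)
      rw [norm_exp_ofReal_mul_I]
    · fun_prop
    · refine Eventually.of_forall fun x τ _ => ?_
      rw [norm_mul, norm_exp_ofReal_mul_I, norm_mul, norm_I, norm_real]
      simp
    · refine Eventually.of_forall fun x τ _ => HasDerivAt.cexp ?_
      have : HasDerivAt (fun τ : ℝ => ⟪x, t + τ • v⟫) ⟪x, v⟫ τ := by
        simp_rw [inner_add_right, real_inner_smul_right]
        simpa using ((hasDerivAt_id τ).mul_const ⟪x, v⟫).const_add ⟪x, t⟫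
      exact this.ofReal_comp.mul_const I
  have h2 : HasDerivAt (fun τ : ℝ => ∫ x, exp (⟪x, t + τ • v⟫ * I) ∂(stdGaussian E))
      (exp (-‖t‖ ^ 2 / 2) * (-⟪v, t⟫ : ℝ)) 0 := by
    simp_rw [← charFun_apply, charFun_stdGaussian]
    have h3 : HasDerivAt (fun τ : ℝ => -‖t + τ • v‖ ^ 2 / 2) (-⟪v, t⟫) 0 := by
      have : (fun τ : ℝ => -‖t + τ • v‖ ^ 2 / 2) =
          fun τ : ℝ => -‖t‖ ^ 2 / 2 + -⟪v, t⟫ * τ + -‖v‖ ^ 2 / 2 * τ ^ 2 := by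
        ext τ
        rw [norm_add_sq_real, real_inner_smul_right, norm_smul, mul_pow, Real.norm_eq_abs, sq_abs,
          real_inner_comm]
        ring
      rw [this]
      have h4 := (((hasDerivAt_id' (0 : ℝ)).const_mul (-⟪v, t⟫)).const_add (-‖t‖ ^ 2 / 2)).fun_add
        (((hasDerivAt_id' (0 : ℝ)).fun_pow 2).const_mul (-‖v‖ ^ 2 / 2))
      exact h4.congr_deriv (by simp)
    simpa using h3.ofReal_comp.cexp
  have h3 := h1.unique h2
  simp only [zero_smul, add_zero] at h3
  have h4 : ∫ x, ((⟪x, v⟫ : ℝ) : ℂ) * exp (⟪x, t⟫ * I) ∂(stdGaussian E) =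
      -I * ∫ x, exp (⟪x, t⟫ * I) * (⟪x, v⟫ * I) ∂(stdGaussian E) := by
    rw [← integral_const_mul]
    congr 1
    ext x
    linear_combination (((⟪x, v⟫ : ℝ) : ℂ) * exp (⟪x, t⟫ * I)) * I_sq
  rw [h4, h3]
  push_cast
  ring

end Mehler

/-! ### Fock coefficients and the first-chaos estimate -/

section ChaosEstimate

open Complex Finset
open scoped ComplexConjugate InnerProductSpace

variable {ι : Type*} [Fintype ι]

theorem memLp_coordinate (p : ENNReal) (hp : p ≠ ⊤) (i : ι) :
    MemLp (fun x : EuclideanSpace ℝ ι => ((x i : ℝ) : ℂ)) p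
      (stdGaussian (EuclideanSpace ℝ ι)) := by
  have h : MemLp (fun x : EuclideanSpace ℝ ι => x i) p (stdGaussian (EuclideanSpace ℝ ι)) :=
    ContinuousLinearMap.comp_memLp' (EuclideanSpace.proj i : EuclideanSpace ℝ ι →L[ℝ] ℝ)
      (IsGaussian.memLp_id (stdGaussian (EuclideanSpace ℝ ι)) p hp)
  exact h.ofReal

/-- The `i`-th coordinate as an element of `L²(γ)`. -/
def coordL2 (i : ι) : Lp ℂ 2 (stdGaussian (EuclideanSpace ℝ ι)) :=
  (memLp_coordinate 2 (by norm_num) i).toLp _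

theorem inner_coordL2_charL2 (i : ι) (t : EuclideanSpace ℝ ι) :
    ⟪coordL2 i, charL2 (stdGaussian (EuclideanSpace ℝ ι)) t⟫_ℂ =
      I * t i * exp (-‖t‖ ^ 2 / 2) := by
  classical
  have h := integral_inner_mul_exp_stdGaussian (EuclideanSpace.single i (1 : ℝ)) t
  have e1 : ∀ x : EuclideanSpace ℝ ι, ⟪x, EuclideanSpace.single i (1 : ℝ)⟫_ℝ = x i := fun x => by
    simp [EuclideanSpace.inner_single_right]
  rw [real_inner_comm, e1] at h
  simp_rw [e1] at h
  rw [← h, L2.inner_def]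
  refine integral_congr_ae ?_
  filter_upwards [coeFn_charL2 (μ := stdGaussian (EuclideanSpace ℝ ι)) t,
    (memLp_coordinate (ι := ι) 2 (by norm_num) i).coeFn_toLp] with x h1 h2
  rw [h1, coordL2, h2, RCLike.inner_apply, BoundedContinuousFunction.innerProbChar_apply]
  simp [mul_comm]

/-- The coefficients, of order `k` in the Fock space, of a linear combination of characters. -/
def fockCoeff (k : ℕ) (b : EuclideanSpace ℝ ι →₀ ℂ) (α : Fin k → ι) : ℂ :=
  ∑ s ∈ b.support, b s * exp (-‖s‖ ^ 2 / 2) * ∏ i, (s (α i) : ℂ)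

/-- The power `⟪s, t⟫ ^ k` is the inner product of the k-th tensor powers of s and t. On characters
this replaces any use of Hermite polynomials. -/
theorem sum_conj_fockCoeff_mul (k : ℕ) (b c : EuclideanSpace ℝ ι →₀ ℂ) :
    ∑ α : Fin k → ι, conj (fockCoeff k b α) * fockCoeff k c α =
      ∑ s ∈ b.support, ∑ t ∈ c.support, conj (b s) * c t *
        (exp (-‖s‖ ^ 2 / 2) * exp (-‖t‖ ^ 2 / 2) * (⟪s, t⟫_ℝ : ℂ) ^ k) := by
  have hconj : ∀ s : EuclideanSpace ℝ ι,
      conj (exp (-‖s‖ ^ 2 / 2)) = exp (-‖s‖ ^ 2 / 2) := fun s => by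
    rw [show (-(‖s‖ : ℂ) ^ 2 / 2) = ((-‖s‖ ^ 2 / 2 : ℝ) : ℂ) by push_cast; rfl, ← exp_conj,
      conj_ofReal]
  simp_rw [fockCoeff, map_sum, sum_mul_sum]
  rw [sum_comm]
  refine sum_congr rfl fun s _ => ?_
  rw [sum_comm]
  refine sum_congr rfl fun t _ => ?_
  have hin : (⟪s, t⟫_ℝ : ℂ) = ∑ i, (s i : ℂ) * (t i : ℂ) := by
    rw [PiLp.inner_apply]
    push_cast
    exact sum_congr rfl fun i _ => by simp [mul_comm]
  rw [hin, Fintype.sum_pow, mul_sum, mul_sum]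
  refine sum_congr rfl fun α _ => ?_
  rw [map_mul, map_mul, hconj, map_prod, prod_mul_distrib]
  simp only [conj_ofReal]
  ring

theorem inner_linearCombination {H H' : Type*} [NormedAddCommGroup H] [InnerProductSpace ℂ H]
    [AddCommGroup H'] [Module ℂ H'] {κ : Type*} (S T : H' →ₗ[ℂ] H) (v : κ → H') (b c : κ →₀ ℂ) :
    ⟪S (Finsupp.linearCombination ℂ v b), T (Finsupp.linearCombination ℂ v c)⟫_ℂ =
      ∑ s ∈ b.support, ∑ t ∈ c.support, conj (b s) * c t * ⟪S (v s), T (v t)⟫_ℂ := by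
  rw [Finsupp.linearCombination_apply, Finsupp.linearCombination_apply, Finsupp.sum, Finsupp.sum,
    map_sum, map_sum, sum_inner]
  refine sum_congr rfl fun s _ => ?_
  rw [inner_sum]
  refine sum_congr rfl fun t _ => ?_
  rw [map_smul, map_smul, inner_smul_left, inner_smul_right]
  ring

theorem hasSum_exp_ofReal_mul (ρ x : ℝ) :
    HasSum (fun k : ℕ => (ρ : ℂ) ^ k / k.factorial * (x : ℂ) ^ k) (exp (ρ * x)) := by
  have h := NormedSpace.expSeries_div_hasSum_exp ((ρ : ℂ) * x)
  rw [← Complex.exp_eq_exp_ℂ] at h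
  convert! h using 2 with k
  rw [mul_pow]; ring

/-- The Mehler expansion. -/
theorem hasSum_inner_fstL2_correlatedL2 {ρ : ℝ} (hρ : |ρ| ≤ 1) (b c : EuclideanSpace ℝ ι →₀ ℂ) :
    HasSum (fun k : ℕ => (ρ : ℂ) ^ k / k.factorial *
      ∑ α : Fin k → ι, conj (fockCoeff k b α) * fockCoeff k c α)
      ⟪fstL2 (Finsupp.linearCombination ℂ (charL2 (stdGaussian (EuclideanSpace ℝ ι))) b),
        correlatedL2 hρ
          (Finsupp.linearCombination ℂ (charL2 (stdGaussian (EuclideanSpace ℝ ι))) c)⟫_ℂ := by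
  have h := inner_linearCombination fstL2.toLinearMap (correlatedL2 hρ).toLinearMap
    (charL2 (stdGaussian (EuclideanSpace ℝ ι))) b c
  simp only [LinearIsometry.coe_toLinearMap] at h
  rw [h]
  simp_rw [sum_conj_fockCoeff_mul, mul_sum, inner_fstL2_correlatedL2_charL2]
  refine hasSum_sum fun s _ => hasSum_sum fun t _ => ?_
  convert! (hasSum_exp_ofReal_mul ρ ⟪s, t⟫_ℝ).mul_left
    (conj (b s) * c t * (exp (-‖s‖ ^ 2 / 2) * exp (-‖t‖ ^ 2 / 2))) using 1
  · ext k; ring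
  · ring

/-- Parseval's identity for the chaos decomposition; the same expansion as Mehler's, at ρ = 1. -/
theorem hasSum_norm_fockCoeff_sq (b : EuclideanSpace ℝ ι →₀ ℂ) :
    HasSum (fun k : ℕ => (∑ α : Fin k → ι, ‖fockCoeff k b α‖ ^ 2) / k.factorial)
      (‖Finsupp.linearCombination ℂ (charL2 (stdGaussian (EuclideanSpace ℝ ι))) b‖ ^ 2) := by
  have h := inner_linearCombination LinearMap.id LinearMap.id
    (charL2 (stdGaussian (EuclideanSpace ℝ ι))) b b
  simp only [LinearMap.id_apply, inner_charL2] at h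
  have h' := inner_self_eq_norm_sq_to_K (𝕜 := ℂ)
    (Finsupp.linearCombination ℂ (charL2 (stdGaussian (EuclideanSpace ℝ ι))) b)
  rw [h] at h'
  rw [← hasSum_ofReal, ofReal_pow]
  rw [show ((‖Finsupp.linearCombination ℂ (charL2 (stdGaussian (EuclideanSpace ℝ ι))) b‖ : ℂ)) ^ 2 =
    _ from h'.symm]
  have e : ∀ k : ℕ, (((∑ α : Fin k → ι, ‖fockCoeff k b α‖ ^ 2) / k.factorial : ℝ) : ℂ) =
      1 / k.factorial * ∑ α : Fin k → ι, conj (fockCoeff k b α) * fockCoeff k b α := by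
    intro k
    push_cast
    simp_rw [conj_mul']
    ring
  simp_rw [e, sum_conj_fockCoeff_mul, mul_sum]
  refine hasSum_sum fun s _ => hasSum_sum fun t _ => ?_
  convert! (hasSum_exp_ofReal_mul 1 ⟪s, t⟫_ℝ).mul_left
    (conj (b s) * b t * (exp (-‖s‖ ^ 2 / 2) * exp (-‖t‖ ^ 2 / 2))) using 1
  · ext k; simp; ring
  · simp; ring

theorem inner_coordL2_linearCombination (i : ι) (c : EuclideanSpace ℝ ι →₀ ℂ) :
    ⟪coordL2 i, Finsupp.linearCombination ℂ (charL2 (stdGaussian (EuclideanSpace ℝ ι))) c⟫_ℂ =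
      I * fockCoeff 1 c fun _ => i := by
  rw [Finsupp.linearCombination_apply, Finsupp.sum, inner_sum, fockCoeff, mul_sum]
  refine sum_congr rfl fun t _ => ?_
  rw [inner_smul_right, inner_coordL2_charL2]
  simp
  ring

theorem sum_inner_coordL2_mul (b c : EuclideanSpace ℝ ι →₀ ℂ) :
    ∑ i, ⟪Finsupp.linearCombination ℂ (charL2 (stdGaussian (EuclideanSpace ℝ ι))) b,
        coordL2 i⟫_ℂ *
      ⟪coordL2 i, Finsupp.linearCombination ℂ (charL2 (stdGaussian (EuclideanSpace ℝ ι))) c⟫_ℂ =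
      ∑ α : Fin 1 → ι, conj (fockCoeff 1 b α) * fockCoeff 1 c α := by
  refine Fintype.sum_equiv (Equiv.funUnique (Fin 1) ι).symm _ _ fun i => ?_
  rw [← inner_conj_symm, inner_coordL2_linearCombination, inner_coordL2_linearCombination,
    map_mul, conj_I]
  have : (Equiv.funUnique (Fin 1) ι).symm i = fun _ => i := rfl
  rw [this]
  linear_combination (-conj (fockCoeff 1 b fun _ => i) * fockCoeff 1 c fun _ => i) * I_sq

/-- A combination of Mehler operators whose first moment is `1` and whose other moments are small
approximates the projection onto the first chaos. -/
theorem norm_sum_inner_coordL2_sub_le {s : Finset ℕ} {a : ℕ → ℂ} {ρ : ℕ → ℝ} {η : ℝ}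
    (hη : 0 ≤ η) (hρ : ∀ j, |ρ j| ≤ 1) (h1 : ∑ j ∈ s, a j * (ρ j : ℂ) = 1)
    (hk : ∀ k ≠ 1, ‖∑ j ∈ s, a j * (ρ j : ℂ) ^ k‖ ≤ η)
    (f h : Lp ℂ 2 (stdGaussian (EuclideanSpace ℝ ι))) :
    ‖∑ i, ⟪f, coordL2 i⟫_ℂ * ⟪coordL2 i, h⟫_ℂ -
      ∑ j ∈ s, a j * ⟪fstL2 f, correlatedL2 (hρ j) h⟫_ℂ‖ ≤ η * ((‖f‖ ^ 2 + ‖h‖ ^ 2) / 2) := by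
  -- Both sides are continuous in `(f, h)`, so combinations of characters suffice.
  refine ((dense_span_charL2 (μ := stdGaussian (EuclideanSpace ℝ ι))).prod
    dense_span_charL2).induction (P := fun p : Lp ℂ 2 (stdGaussian (EuclideanSpace ℝ ι)) ×
      Lp ℂ 2 (stdGaussian (EuclideanSpace ℝ ι)) =>
      ‖∑ i, ⟪p.1, coordL2 i⟫_ℂ * ⟪coordL2 i, p.2⟫_ℂ -
      ∑ j ∈ s, a j * ⟪fstL2 p.1, correlatedL2 (hρ j) p.2⟫_ℂ‖ ≤
        η * ((‖p.1‖ ^ 2 + ‖p.2‖ ^ 2) / 2)) ?_ ?_ (f, h)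
  · rintro ⟨f, h⟩ ⟨hf, hh⟩
    obtain ⟨b, rfl⟩ := (Finsupp.mem_span_range_iff_exists_finsupp).1 hf
    obtain ⟨c, rfl⟩ := (Finsupp.mem_span_range_iff_exists_finsupp).1 hh
    simp only [← Finsupp.linearCombination_apply]
    set G : ℕ → ℂ := fun k => ∑ α : Fin k → ι, conj (fockCoeff k b α) * fockCoeff k c α with hG
    rw [sum_inner_coordL2_mul]
    have hs1 : HasSum (fun k : ℕ => if k = 1 then G 1 else 0) (G 1) := hasSum_ite_eq 1 (G 1)
    have hs2 := hasSum_sum (s := s) fun j _ =>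
      (hasSum_inner_fstL2_correlatedL2 (hρ j) b c).mul_left (a j)
    have hs3 := (((hasSum_norm_fockCoeff_sq b).add (hasSum_norm_fockCoeff_sq c)).div_const
      2).mul_left η
    -- Comparison order by order: order 1 cancels, and every other order carries a multiplier at
    -- most η. Bounding products by half sums of squares lets Parseval sum the majorant.
    refine (hs1.sub hs2).norm_le_of_bounded hs3 fun k => ?_
    have hG_le : ‖G k‖ ≤ (∑ α : Fin k → ι, ‖fockCoeff k b α‖ ^ 2 +
        ∑ α : Fin k → ι, ‖fockCoeff k c α‖ ^ 2) / 2 := by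
      rw [← sum_add_distrib, sum_div]
      refine (norm_sum_le _ _).trans (sum_le_sum fun α _ => ?_)
      rw [norm_mul, norm_conj]
      nlinarith [sq_nonneg (‖fockCoeff k b α‖ - ‖fockCoeff k c α‖)]
    have hfac : (∑ j ∈ s, a j * ((ρ j : ℂ) ^ k / k.factorial * G k)) =
        (∑ j ∈ s, a j * (ρ j : ℂ) ^ k) * (G k / k.factorial) := by
      rw [sum_mul]
      exact sum_congr rfl fun j _ => by ring
    rw [hfac]
    by_cases hk1 : k = 1
    · subst hk1
      simp only [if_true, pow_one, h1, Nat.factorial_one, Nat.cast_one, div_one, one_mul, sub_self,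
        norm_zero]
      positivity
    · rw [if_neg hk1, zero_sub, norm_neg, norm_mul, norm_div]
      refine mul_le_mul (hk k hk1) ?_ (by positivity) hη
      rw [Complex.norm_natCast, ← add_div, div_right_comm]
      gcongr
  · refine isClosed_le ?_ ?_
    · fun_prop
    · fun_prop

end ChaosEstimate

/-! ### Averaging functionals over the fibers of a simple function -/

section Fibers

open Finset
open scoped ComplexConjugate InnerProductSpace ENNReal

variable {X W : Type*} [MeasurableSpace X] {μ : Measure X} [IsProbabilityMeasure μ]

variable (μ) in
/-- The indicator function of a fiber of a simple function. -/
def fiberLp (p : ℝ≥0∞) (S : SimpleFunc X W) (v : W) : Lp ℂ p μ :=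
  indicatorConstLp p (S.measurableSet_fiber v) (measure_ne_top μ _) 1

theorem norm_fiberLp_one (S : SimpleFunc X W) (v : W) :
    ‖fiberLp μ 1 S v‖ = μ.real (S ⁻¹' {v}) := by
  rw [fiberLp, norm_indicatorConstLp one_ne_zero ENNReal.one_ne_top]
  simp

theorem sum_smul_fiberLp_ae_eq (p : ℝ≥0∞) (S : SimpleFunc X W) (φ : W → ℂ) :
    (∑ v ∈ S.range, φ v • fiberLp μ p S v : Lp ℂ p μ) =ᵐ[μ] fun x => φ (S x) := by
  classical
  have key : ∀ s : Finset W, (∑ v ∈ s, φ v • fiberLp μ p S v : Lp ℂ p μ) =ᵐ[μ]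
      fun x => if S x ∈ s then φ (S x) else 0 := by
    intro s
    induction s using Finset.induction_on with
    | empty =>
      simp only [sum_empty, notMem_empty, if_false]
      exact Lp.coeFn_zero _ _ _
    | insert a s ha ih =>
      rw [sum_insert ha]
      filter_upwards [Lp.coeFn_add (φ a • fiberLp μ p S a) (∑ v ∈ s, φ v • fiberLp μ p S v), ih,
        Lp.coeFn_smul (φ a) (fiberLp μ p S a),
        indicatorConstLp_coeFn (p := p) (hs := S.measurableSet_fiber a)
          (hμs := measure_ne_top μ _) (c := (1 : ℂ))] with x h1 h2 h3 h4
      rw [h1, Pi.add_apply, h2, h3, Pi.smul_apply, fiberLp, h4]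
      by_cases hx : S x = a
      · subst hx
        simp [ha]
      · simp [hx]
  refine (key S.range).trans (Eventually.of_forall fun x => ?_)
  simp

/-- The sets are disjoint, being the fibers of `y ↦ (S (f y), S (g y))`, and ν is a probability. -/
theorem sum_measureReal_fiber_inter_le {Y : Type*} [MeasurableSpace Y] {ν : Measure Y}
    [IsProbabilityMeasure ν] (S : SimpleFunc X W) {f g : Y → X} (hf : Measurable f)
    (hg : Measurable g) :
    ∑ v ∈ S.range, ∑ v' ∈ S.range, ν.real (f ⁻¹' (S ⁻¹' {v}) ∩ g ⁻¹' (S ⁻¹' {v'})) ≤ 1 := by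
  have hpre : ∀ b : W × W, (fun y => (S (f y), S (g y))) ⁻¹' {b} =
      f ⁻¹' (S ⁻¹' {b.1}) ∩ g ⁻¹' (S ⁻¹' {b.2}) := by
    intro b; ext y; simp [Prod.ext_iff]
  rw [← sum_product']
  have h := sum_measureReal_preimage_singleton (μ := ν) (S.range ×ˢ S.range)
    (f := fun y => (S (f y), S (g y))) fun b _ => by
      rw [hpre]
      exact (hf (S.measurableSet_fiber _)).inter (hg (S.measurableSet_fiber _))
  simp only [hpre] at h
  rw [h]
  exact measureReal_le_one

/-- The average of a functional on `L¹` over the fibers of a simple function. -/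
def fiberAverage (S : SimpleFunc X W) (F : Lp ℂ 1 μ →L[ℂ] ℂ) (v : W) : ℂ :=
  F (fiberLp μ 1 S v) / μ.real (S ⁻¹' {v})

theorem norm_apply_fiberLp_le {S : SimpleFunc X W} {F : Lp ℂ 1 μ →L[ℂ] ℂ} (hF : ‖F‖ ≤ 1) (v : W) :
    ‖F (fiberLp μ 1 S v)‖ ≤ μ.real (S ⁻¹' {v}) := by
  refine (F.le_of_opNorm_le hF _).trans_eq ?_
  rw [one_mul, norm_fiberLp_one]

theorem norm_fiberAverage_le {S : SimpleFunc X W} {F : Lp ℂ 1 μ →L[ℂ] ℂ} (hF : ‖F‖ ≤ 1) (v : W) :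
    ‖fiberAverage S F v‖ ≤ 1 := by
  rw [fiberAverage, norm_div, Complex.norm_real, Real.norm_of_nonneg measureReal_nonneg]
  exact div_le_one_of_le₀ (norm_apply_fiberLp_le hF v) measureReal_nonneg

theorem fiberAverage_mul {S : SimpleFunc X W} {F : Lp ℂ 1 μ →L[ℂ] ℂ} (hF : ‖F‖ ≤ 1) (v : W) :
    F (fiberLp μ 1 S v) = fiberAverage S F v * μ.real (S ⁻¹' {v}) := by
  -- On a null fiber the quotient is 0 by convention, and F vanishes there too because the indicator
  -- has norm 0.
  by_cases h : μ.real (S ⁻¹' {v}) = 0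
  · have := norm_apply_fiberLp_le (S := S) hF v
    rw [h] at this ⊢
    rw [norm_le_zero_iff.1 this]; simp
  · rw [fiberAverage, div_mul_cancel₀]
    exact_mod_cast h

theorem norm_sum_smul_fiberLp_two_le (S : SimpleFunc X W) {φ : W → ℂ} (hφ : ∀ v, ‖φ v‖ ≤ 1) :
    ‖∑ v ∈ S.range, φ v • fiberLp μ 2 S v‖ ≤ 1 := by
  have h : ∀ᵐ x ∂μ, ‖(∑ v ∈ S.range, φ v • fiberLp μ 2 S v : Lp ℂ 2 μ) x‖ ≤ 1 := by
    filter_upwards [sum_smul_fiberLp_ae_eq (μ := μ) 2 S φ] with x hx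
    rw [hx]
    exact hφ _
  simpa [measureUnivNNReal] using Lp.norm_le_of_ae_bound zero_le_one h

end Fibers

/-! ### Decomposing the tensor of Gaussian coordinates -/

section Decomposition

open Finset
open scoped ComplexConjugate InnerProductSpace ENNReal

variable {ι : Type*} [Fintype ι]

/-- The `i`-th coordinate as an element of `L¹(γ)`. -/
def coordL1 (i : ι) : Lp ℂ 1 (stdGaussian (EuclideanSpace ℝ ι)) :=
  (memLp_coordinate 1 (by norm_num) i).toLp _

variable {S : SimpleFunc (EuclideanSpace ℝ ι) (EuclideanSpace ℝ ι)} {ε : ℝ}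

theorem integrable_sub_simpleFunc
    (S : SimpleFunc (EuclideanSpace ℝ ι) (EuclideanSpace ℝ ι)) :
    Integrable (fun x => ‖x - S x‖) (stdGaussian (EuclideanSpace ℝ ι)) :=
  (IsGaussian.integrable_id.sub (S.integrable_of_isFiniteMeasure)).norm

theorem norm_ofReal_coordinate_sub_le (x y : EuclideanSpace ℝ ι) (i : ι) :
    ‖((x i : ℝ) : ℂ) - ((y i : ℝ) : ℂ)‖ ≤ ‖x - y‖ := by
  rw [← Complex.ofReal_sub, Complex.norm_real]
  exact PiLp.norm_apply_le (x - y) i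

theorem norm_coordL1_sub_le (i : ι)
    (hS : ∫ x, ‖x - S x‖ ∂(stdGaussian (EuclideanSpace ℝ ι)) ≤ ε) :
    ‖coordL1 i - ∑ v ∈ S.range, ((v i : ℝ) : ℂ) •
      fiberLp (stdGaussian (EuclideanSpace ℝ ι)) 1 S v‖ ≤ ε := by
  rw [L1.norm_eq_integral_norm]
  refine (integral_mono_ae (L1.integrable_coeFn _).norm (integrable_sub_simpleFunc S) ?_).trans hS
  filter_upwards [Lp.coeFn_sub (coordL1 i) (∑ v ∈ S.range, ((v i : ℝ) : ℂ) •
      fiberLp (stdGaussian (EuclideanSpace ℝ ι)) 1 S v),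
    sum_smul_fiberLp_ae_eq (μ := stdGaussian (EuclideanSpace ℝ ι)) 1 S
      (fun v => ((v i : ℝ) : ℂ)),
    (memLp_coordinate (ι := ι) 1 (by norm_num) i).coeFn_toLp] with x h1 h2 h3
  rw [h1, Pi.sub_apply, h2, coordL1, h3]
  exact norm_ofReal_coordinate_sub_le _ _ _

theorem integral_fiberAverage_mul_coordinate
    {F : Lp ℂ 1 (stdGaussian (EuclideanSpace ℝ ι)) →L[ℂ] ℂ} (hF : ‖F‖ ≤ 1) (i : ι) :
    ∫ x, fiberAverage S F (S x) * ((S x i : ℝ) : ℂ) ∂(stdGaussian (EuclideanSpace ℝ ι)) =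
      F (∑ v ∈ S.range, ((v i : ℝ) : ℂ) •
        fiberLp (stdGaussian (EuclideanSpace ℝ ι)) 1 S v) := by
  have h := S.map_integral (μ := stdGaussian (EuclideanSpace ℝ ι))
    (fun v => fiberAverage S F v * ((v i : ℝ) : ℂ)) S.integrable_of_isFiniteMeasure (by simp)
  rw [SimpleFunc.integral_eq_integral _ (SimpleFunc.integrable_of_isFiniteMeasure _)] at h
  simp only [SimpleFunc.coe_map, Function.comp_apply] at h
  rw [h, map_sum]
  refine sum_congr rfl fun v _ => ?_
  rw [map_smul, fiberAverage_mul hF, Complex.real_smul, smul_eq_mul]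
  ring

/-- Fiber averages represent F exactly on functions constant on fibers. One ε is paid to discretize
the coordinate inside F, another to undo this inside the integral. -/
theorem norm_apply_coordL1_sub_integral_le
    {F : Lp ℂ 1 (stdGaussian (EuclideanSpace ℝ ι)) →L[ℂ] ℂ} (hF : ‖F‖ ≤ 1) (i : ι)
    (hS : ∫ x, ‖x - S x‖ ∂(stdGaussian (EuclideanSpace ℝ ι)) ≤ ε) :
    ‖F (coordL1 i) -
      ∫ x, fiberAverage S F (S x) * ((x i : ℝ) : ℂ) ∂(stdGaussian (EuclideanSpace ℝ ι))‖ ≤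
      2 * ε := by
  set σ := ∑ v ∈ S.range, ((v i : ℝ) : ℂ) •
    fiberLp (stdGaussian (EuclideanSpace ℝ ι)) 1 S v with hσ
  have h1 : ‖F (coordL1 i) - F σ‖ ≤ ε := by
    rw [← map_sub]
    exact ((F.le_of_opNorm_le hF _).trans_eq (one_mul _)).trans (norm_coordL1_sub_le i hS)
  have hm : AEStronglyMeasurable (fun x => fiberAverage S F (S x))
      (stdGaussian (EuclideanSpace ℝ ι)) :=
    (S.map (fiberAverage S F)).aestronglyMeasurable
  have hb : ∀ᵐ x ∂(stdGaussian (EuclideanSpace ℝ ι)), ‖fiberAverage S F (S x)‖ ≤ 1 :=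
    Eventually.of_forall fun x => norm_fiberAverage_le hF _
  have hSi : Integrable (fun x => ((S x i : ℝ) : ℂ)) (stdGaussian (EuclideanSpace ℝ ι)) :=
    (S.map fun v : EuclideanSpace ℝ ι => ((v i : ℝ) : ℂ)).integrable_of_isFiniteMeasure
  have hxi := memLp_one_iff_integrable.1 (memLp_coordinate (ι := ι) 1 (by norm_num) i)
  have h2 : ‖F σ -
      ∫ x, fiberAverage S F (S x) * ((x i : ℝ) : ℂ) ∂(stdGaussian (EuclideanSpace ℝ ι))‖ ≤ ε := by
    rw [hσ, ← integral_fiberAverage_mul_coordinate hF i, norm_sub_rev,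
      ← integral_sub (hxi.bdd_mul hm hb) (hSi.bdd_mul hm hb)]
    refine (norm_integral_le_of_norm_le (integrable_sub_simpleFunc S)
      (Eventually.of_forall fun x => ?_)).trans hS
    rw [← mul_sub, norm_mul]
    exact (mul_le_of_le_one_left (norm_nonneg _) (norm_fiberAverage_le hF _)).trans
      (norm_ofReal_coordinate_sub_le _ _ _)
  linarith [norm_sub_le_norm_sub_add_norm_sub (F (coordL1 i)) (F σ)
    (∫ x, fiberAverage S F (S x) * ((x i : ℝ) : ℂ) ∂(stdGaussian (EuclideanSpace ℝ ι)))]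

theorem inner_coordL2_sum_smul_fiberLp (φ : EuclideanSpace ℝ ι → ℂ) (i : ι) :
    ⟪coordL2 i, ∑ v ∈ S.range, φ v • fiberLp (stdGaussian (EuclideanSpace ℝ ι)) 2 S v⟫_ℂ =
      ∫ x, φ (S x) * ((x i : ℝ) : ℂ) ∂(stdGaussian (EuclideanSpace ℝ ι)) := by
  rw [L2.inner_def]
  refine integral_congr_ae ?_
  filter_upwards [sum_smul_fiberLp_ae_eq (μ := stdGaussian (EuclideanSpace ℝ ι)) 2 S φ,
    (memLp_coordinate (ι := ι) 2 (by norm_num) i).coeFn_toLp] with x h1 h2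
  rw [h1, coordL2, h2, RCLike.inner_apply]
  simp

theorem inner_sum_conj_smul_fiberLp_coordL2 (φ : EuclideanSpace ℝ ι → ℂ) (i : ι) :
    ⟪∑ v ∈ S.range, conj (φ v) • fiberLp (stdGaussian (EuclideanSpace ℝ ι)) 2 S v,
      coordL2 i⟫_ℂ =
      ∫ x, φ (S x) * ((x i : ℝ) : ℂ) ∂(stdGaussian (EuclideanSpace ℝ ι)) := by
  rw [← inner_conj_symm, inner_coordL2_sum_smul_fiberLp, ← integral_conj]
  simp

/-- The joint law of a `ρ`-correlated pair, on the fibers of a simple function. -/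
def fiberLaw (S : SimpleFunc (EuclideanSpace ℝ ι) (EuclideanSpace ℝ ι)) (ρ : ℝ)
    (v v' : EuclideanSpace ℝ ι) : ℝ :=
  ((stdGaussian (EuclideanSpace ℝ ι)).prod (stdGaussian (EuclideanSpace ℝ ι))).real
    (Prod.fst ⁻¹' (S ⁻¹' {v}) ∩ correlated ρ ⁻¹' (S ⁻¹' {v'}))

theorem inner_fstL2_correlatedL2_fiberLp {ρ : ℝ} (hρ : |ρ| ≤ 1)
    (φ ψ : EuclideanSpace ℝ ι → ℂ) :
    ⟪fstL2 (∑ v ∈ S.range, conj (φ v) • fiberLp (stdGaussian (EuclideanSpace ℝ ι)) 2 S v),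
      correlatedL2 hρ
        (∑ v ∈ S.range, ψ v • fiberLp (stdGaussian (EuclideanSpace ℝ ι)) 2 S v)⟫_ℂ =
      ∑ v ∈ S.range, ∑ v' ∈ S.range, φ v * ψ v' * fiberLaw S ρ v v' := by
  rw [map_sum, map_sum, sum_inner]
  refine sum_congr rfl fun v _ => ?_
  rw [inner_sum]
  refine sum_congr rfl fun v' _ => ?_
  rw [map_smul, map_smul, inner_smul_left, inner_smul_right, Complex.conj_conj, ← mul_assoc]
  congr 1
  exact L2.inner_indicatorConstLp_one_indicatorConstLp_one (𝕜 := ℂ)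
    (measurable_fst (S.measurableSet_fiber v))
    (measurable_correlated ρ (S.measurableSet_fiber v')) (measure_ne_top _ _) (measure_ne_top _ _)

/-- The coefficients of the discretized combination of Mehler kernels. -/
def kernelCoeff (S : SimpleFunc (EuclideanSpace ℝ ι) (EuclideanSpace ℝ ι)) (a : ℕ → ℂ)
    (ρ : ℕ → ℝ) (j : ℕ) (v v' : EuclideanSpace ℝ ι) : ℂ :=
  a j * (fiberLaw S (ρ j) v v' / ((stdGaussian (EuclideanSpace ℝ ι)).real (S ⁻¹' {v}) *
    (stdGaussian (EuclideanSpace ℝ ι)).real (S ⁻¹' {v'})) : ℝ)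

/-- The discretization, along a simple function, of a combination of Mehler kernels. -/
def discreteKernel (S : SimpleFunc (EuclideanSpace ℝ ι) (EuclideanSpace ℝ ι)) (s : Finset ℕ)
    (a : ℕ → ℂ) (ρ : ℕ → ℝ) : Lp ℂ 1 (stdGaussian (EuclideanSpace ℝ ι)) ⊗[ℂ]
      Lp ℂ 1 (stdGaussian (EuclideanSpace ℝ ι)) :=
  ∑ j ∈ s, ∑ v ∈ S.range, ∑ v' ∈ S.range, (kernelCoeff S a ρ j v v' •
    fiberLp (stdGaussian (EuclideanSpace ℝ ι)) 1 S v) ⊗ₜ[ℂ]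
    fiberLp (stdGaussian (EuclideanSpace ℝ ι)) 1 S v'

/-- The L¹ norms of the two indicators cancel the denominators, leaving `‖a j‖` times a joint law of
total mass at most 1. -/
theorem projectiveNorm_discreteKernel_le (s : Finset ℕ) (a : ℕ → ℂ) (ρ : ℕ → ℝ) :
    projectiveNorm (discreteKernel S s a ρ) ≤ ∑ j ∈ s, ‖a j‖ := by
  have h : discreteKernel S s a ρ = ∑ q : ↥(s ×ˢ S.range ×ˢ S.range),
      (kernelCoeff S a ρ q.1.1 q.1.2.1 q.1.2.2 •
        fiberLp (stdGaussian (EuclideanSpace ℝ ι)) 1 S q.1.2.1) ⊗ₜ[ℂ]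
        fiberLp (stdGaussian (EuclideanSpace ℝ ι)) 1 S q.1.2.2 := by
    rw [sum_coe_sort (s ×ˢ S.range ×ˢ S.range) fun q => (kernelCoeff S a ρ q.1 q.2.1 q.2.2 •
        fiberLp (stdGaussian (EuclideanSpace ℝ ι)) 1 S q.2.1) ⊗ₜ[ℂ]
        fiberLp (stdGaussian (EuclideanSpace ℝ ι)) 1 S q.2.2]
    simp only [sum_product, discreteKernel]
  rw [h]
  refine (projectiveNorm_sum_tmul_le _ _).trans ?_
  rw [sum_coe_sort (s ×ˢ S.range ×ˢ S.range) fun q => ‖kernelCoeff S a ρ q.1 q.2.1 q.2.2 •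
        fiberLp (stdGaussian (EuclideanSpace ℝ ι)) 1 S q.2.1‖ *
        ‖fiberLp (stdGaussian (EuclideanSpace ℝ ι)) 1 S q.2.2‖]
  simp only [sum_product]
  refine sum_le_sum fun j _ => ?_
  calc _ ≤ ∑ v ∈ S.range, ∑ v' ∈ S.range, ‖a j‖ * fiberLaw S (ρ j) v v' := by
        refine sum_le_sum fun v _ => sum_le_sum fun v' _ => ?_
        have hκ : 0 ≤ fiberLaw S (ρ j) v v' := measureReal_nonneg
        rw [norm_smul, norm_fiberLp_one, norm_fiberLp_one, kernelCoeff, norm_mul,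
          Complex.norm_real, Real.norm_of_nonneg (by positivity), mul_assoc, mul_assoc]
        refine mul_le_mul_of_nonneg_left ?_ (norm_nonneg _)
        rw [div_mul_eq_mul_div]
        -- An inequality, since on null fibers the quotient is 0 by convention.
        exact div_le_of_le_mul₀ (by positivity) hκ le_rfl
    _ = ‖a j‖ * ∑ v ∈ S.range, ∑ v' ∈ S.range, fiberLaw S (ρ j) v v' := by
        simp_rw [mul_sum]
    _ ≤ ‖a j‖ := mul_le_of_le_one_right (norm_nonneg _)
        (sum_measureReal_fiber_inter_le S measurable_fst (measurable_correlated (ρ j)))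

/-- This turns the injective norm into an L² question; conjugating the first averages converts the
bilinear pairing into a sesquilinear one. -/
theorem dualDistrib_discreteKernel {s : Finset ℕ} {a : ℕ → ℂ} {ρ : ℕ → ℝ} (hρ : ∀ j, |ρ j| ≤ 1)
    {F H : Lp ℂ 1 (stdGaussian (EuclideanSpace ℝ ι)) →L[ℂ] ℂ} :
    TensorProduct.dualDistrib ℂ _ _ ((F : _ →ₗ[ℂ] ℂ) ⊗ₜ[ℂ] (H : _ →ₗ[ℂ] ℂ))
      (discreteKernel S s a ρ) =
      ∑ j ∈ s, a j * ⟪fstL2 (∑ v ∈ S.range, conj (fiberAverage S F v) •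
        fiberLp (stdGaussian (EuclideanSpace ℝ ι)) 2 S v),
      correlatedL2 (hρ j) (∑ v ∈ S.range, fiberAverage S H v •
        fiberLp (stdGaussian (EuclideanSpace ℝ ι)) 2 S v)⟫_ℂ := by
  simp_rw [inner_fstL2_correlatedL2_fiberLp, discreteKernel, map_sum, mul_sum,
    TensorProduct.dualDistrib_apply]
  refine sum_congr rfl fun j _ => sum_congr rfl fun v _ => sum_congr rfl fun v' _ => ?_
  simp only [map_smul, ContinuousLinearMap.coe_coe, smul_eq_mul, kernelCoeff, fiberAverage]
  push_cast
  ring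

theorem norm_mul_sub_mul_le {x y x' y' : ℂ} {M ε : ℝ} (hε : 0 ≤ ε) (hε1 : ε ≤ 1) (hx : ‖x‖ ≤ M)
    (hy : ‖y‖ ≤ M) (hx' : ‖x - x'‖ ≤ 2 * ε) (hy' : ‖y - y'‖ ≤ 2 * ε) :
    ‖x * y - x' * y'‖ ≤ ε * (4 * M + 4) := by
  have hM : 0 ≤ M := (norm_nonneg x).trans hx
  have hx'' : ‖x'‖ ≤ M + 2 := by
    have := norm_sub_norm_le x' x
    rw [norm_sub_rev] at this
    linarith
  rw [show x * y - x' * y' = (x - x') * y + x' * (y - y') by ring]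
  refine (norm_add_le _ _).trans ?_
  rw [norm_mul, norm_mul]
  have b1 := mul_le_mul hx' hy (norm_nonneg _) (by positivity)
  have b2 := mul_le_mul hx'' hy' (norm_nonneg _) (by positivity)
  linarith

/-- The tensor of a standard Gaussian family splits into a part of small projective norm and a
part of small injective norm. -/
theorem exists_decomposition_coordL1 (ι : Type*) [Fintype ι] {δ : ℝ} (h0 : 0 < δ) (h1 : δ < 1) :
    ∃ t r : Lp ℂ 1 (stdGaussian (EuclideanSpace ℝ ι)) ⊗[ℂ]
        Lp ℂ 1 (stdGaussian (EuclideanSpace ℝ ι)),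
      ∑ i, coordL1 i ⊗ₜ[ℂ] coordL1 i = t + r ∧ projectiveNorm t ≤ massBound δ ∧
        injectiveNorm r ≤ δ := by
  obtain ⟨s, a, ρ, hρ, hmass, hm1, hmk⟩ := exists_moment_weights h0 h1
  -- By `norm_mul_sub_mul_le`, the total discretization error is at most `ε K`. Dividing by `K + 1`
  -- below also covers empty ι.
  set K : ℝ := ∑ i : ι, (4 * ‖coordL1 i‖ + 4) with hK
  have hK0 : 0 ≤ K := sum_nonneg fun i _ => by positivity
  set ε : ℝ := min 1 (δ / (2 * (K + 1))) with hε
  have hε0 : 0 < ε := lt_min one_pos (by positivity)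
  have hε1 : ε ≤ 1 := min_le_left _ _
  have hεK : ε * K ≤ δ / 2 := by
    have : ε ≤ δ / (2 * (K + 1)) := min_le_right _ _
    rw [le_div_iff₀ (by positivity)] at this
    nlinarith
  obtain ⟨S, hSε, -⟩ := (IsGaussian.memLp_id (stdGaussian (EuclideanSpace ℝ ι)) 1
    (by norm_num)).exists_simpleFunc_eLpNorm_sub_lt (by norm_num)
    (ε := ENNReal.ofReal ε) (by simpa using hε0)
  have hS : ∫ x, ‖x - S x‖ ∂(stdGaussian (EuclideanSpace ℝ ι)) ≤ ε := by
    change ∫ x, ‖((id : EuclideanSpace ℝ ι → _) - ⇑S) x‖ ∂(stdGaussian (EuclideanSpace ℝ ι)) ≤ ε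
    rw [integral_norm_eq_lintegral_enorm
      (IsGaussian.integrable_id.sub S.integrable_of_isFiniteMeasure).aestronglyMeasurable]
    rw [eLpNorm_one_eq_lintegral_enorm] at hSε
    exact ENNReal.toReal_le_of_le_ofReal hε0.le hSε.le
  refine ⟨discreteKernel S s a ρ, ∑ i, coordL1 i ⊗ₜ[ℂ] coordL1 i - discreteKernel S s a ρ,
    by abel, (projectiveNorm_discreteKernel_le s a ρ).trans hmass,
    injectiveNorm_le fun F H hF hH => ?_⟩
  rw [map_sub, map_sum, dualDistrib_discreteKernel hρ]
  simp only [TensorProduct.dualDistrib_apply, ContinuousLinearMap.coe_coe]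
  set f := ∑ v ∈ S.range, conj (fiberAverage S F v) •
    fiberLp (stdGaussian (EuclideanSpace ℝ ι)) 2 S v with hf
  set h := ∑ v ∈ S.range, fiberAverage S H v •
    fiberLp (stdGaussian (EuclideanSpace ℝ ι)) 2 S v with hh
  have hf1 : ‖f‖ ≤ 1 := norm_sum_smul_fiberLp_two_le S fun v => by
    rw [RCLike.norm_conj]; exact norm_fiberAverage_le hF v
  have hh1 : ‖h‖ ≤ 1 := norm_sum_smul_fiberLp_two_le S fun v => norm_fiberAverage_le hH v
  have hmain := norm_sum_inner_coordL2_sub_le (by positivity) hρ hm1 hmk f h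
  have hmain' : δ / 2 * ((‖f‖ ^ 2 + ‖h‖ ^ 2) / 2) ≤ δ / 2 := by
    have := pow_le_one₀ (n := 2) (norm_nonneg f) hf1
    have := pow_le_one₀ (n := 2) (norm_nonneg h) hh1
    nlinarith
  have hdiff : ‖∑ i, F (coordL1 i) * H (coordL1 i) -
      ∑ i, ⟪f, coordL2 i⟫_ℂ * ⟪coordL2 i, h⟫_ℂ‖ ≤ ε * K := by
    rw [← sum_sub_distrib, hK, mul_sum]
    refine (norm_sum_le _ _).trans (sum_le_sum fun i _ => ?_)
    have hFi := norm_apply_coordL1_sub_integral_le hF i hS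
    have hHi := norm_apply_coordL1_sub_integral_le hH i hS
    rw [← inner_sum_conj_smul_fiberLp_coordL2, ← hf] at hFi
    rw [← inner_coordL2_sum_smul_fiberLp, ← hh] at hHi
    have hF' : ‖F (coordL1 i)‖ ≤ ‖coordL1 i‖ := (F.le_of_opNorm_le hF _).trans_eq (one_mul _)
    have hH' : ‖H (coordL1 i)‖ ≤ ‖coordL1 i‖ := (H.le_of_opNorm_le hH _).trans_eq (one_mul _)
    exact norm_mul_sub_mul_le hε0.le hε1 hF' hH' hFi hHi
  -- One δ/2 comes from discretization, the other from the moments of order different from 1.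
  exact (norm_sub_le_norm_sub_add_norm_sub _ _ _).trans
    ((add_le_add (hdiff.trans hεK) (hmain.trans hmain')).trans_eq (add_halves δ))

end Decomposition

/-! ### Transfer to real and complex Gaussian families -/

section Transfer

open Finset

variable {Ω T₁ T₂ : Type*} [MeasurableSpace Ω] {P : Measure Ω}
  [MeasurableSpace T₁] {m₁ : Measure T₁} [MeasurableSpace T₂] {m₂ : Measure T₂}

theorem exists_decomposition_of_operators {ι : Type*} [Fintype ι] {δ : ℝ} (h0 : 0 < δ) (h1 : δ < 1)
    {u₁ : Lp ℂ 1 (stdGaussian (EuclideanSpace ℝ ι)) →L[ℂ] Lp ℂ 1 m₁}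
    {u₂ : Lp ℂ 1 (stdGaussian (EuclideanSpace ℝ ι)) →L[ℂ] Lp ℂ 1 m₂}
    (hu₁ : ‖u₁‖ ≤ 1) (hu₂ : ‖u₂‖ ≤ 1) :
    ∃ t r : Lp ℂ 1 m₁ ⊗[ℂ] Lp ℂ 1 m₂,
      ∑ i, u₁ (coordL1 i) ⊗ₜ[ℂ] u₂ (coordL1 i) = t + r ∧
      projectiveNorm t ≤ massBound δ ∧ injectiveNorm r ≤ δ := by
  exact exists_decomposition_map (exists_decomposition_coordL1 ι h0 h1) hu₁ hu₂

theorem IsRealGaussianFamily.precomp {κ ι : Type*} {g : ι → Ω → ℝ}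
    (hg : IsRealGaussianFamily g P) {e : κ → ι} (he : Function.Injective e) :
    IsRealGaussianFamily (fun k => g (e k)) P :=
  ⟨fun k => hg.hasLaw (e k), hg.indep.precomp he⟩

/-- A finite real Gaussian family is the image of the coordinates of the standard Gaussian measure
under an isometric embedding of `L¹` spaces. -/
theorem IsRealGaussianFamily.exists_operator [IsProbabilityMeasure P] {ι : Type*} [Fintype ι]
    {g : ι → Ω → ℝ}
    (hg : IsRealGaussianFamily g P) :
    ∃ Γ : Lp ℂ 1 (stdGaussian (EuclideanSpace ℝ ι)) →L[ℂ] Lp ℂ 1 P, ‖Γ‖ ≤ 1 ∧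
      ∀ i, Γ (coordL1 i) = hg.toL1 i := by
  have hae := fun i => (hg.hasLaw i).aemeasurable
  -- The variables are only almost everywhere measurable, whereas composition on `Lp` needs a
  -- measurable map.
  set G : ι → Ω → ℝ := fun i => (hae i).mk (g i) with hG
  have hGm : ∀ i, Measurable (G i) := fun i => (hae i).measurable_mk
  have hGg : ∀ i, g i =ᵐ[P] G i := fun i => (hae i).ae_eq_mk
  have hind : iIndepFun G P := hg.indep.congr hGg
  have hmap : ∀ i, P.map (G i) = gaussianReal 0 1 := fun i => by
    rw [← Measure.map_congr (hGg i), (hg.hasLaw i).map_eq]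
  have hpi : P.map (fun ω i => G i ω) = Measure.pi fun _ : ι => gaussianReal 0 1 := by
    rw [(iIndepFun_iff_map_fun_eq_pi_map fun i => (hGm i).aemeasurable).1 hind]
    simp_rw [hmap]
  have hmp : MeasurePreserving (fun ω => WithLp.toLp 2 (fun i => G i ω)) P
      (stdGaussian (EuclideanSpace ℝ ι)) := by
    refine ⟨by fun_prop, ?_⟩
    rw [← map_pi_eq_stdGaussian, ← hpi, Measure.map_map (by fun_prop) (by fun_prop)]
    rfl
  refine ⟨(Lp.compMeasurePreservingₗᵢ ℂ _ hmp).toContinuousLinearMap,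
    LinearIsometry.norm_toContinuousLinearMap_le _, fun i => ?_⟩
  refine (Lp.toLp_compMeasurePreserving (memLp_coordinate 1 (by norm_num) i) hmp).trans ?_
  refine MemLp.toLp_congr _ _ ?_
  filter_upwards [hGg i] with ω hω
  simp [hω]

/-- Composition with a linear isometry, as an isometry of `L¹(γ)`. -/
def pullbackL1 {ι : Type*} [Fintype ι] (e : EuclideanSpace ℝ ι ≃ₗᵢ[ℝ] EuclideanSpace ℝ ι) :
    Lp ℂ 1 (stdGaussian (EuclideanSpace ℝ ι)) →ₗᵢ[ℂ]
      Lp ℂ 1 (stdGaussian (EuclideanSpace ℝ ι)) :=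
  Lp.compMeasurePreservingₗᵢ ℂ e ⟨e.continuous.measurable, stdGaussian_map e⟩

theorem pullbackL1_coordL1 {ι : Type*} [Fintype ι]
    {e : EuclideanSpace ℝ ι ≃ₗᵢ[ℝ] EuclideanSpace ℝ ι} {k l : ι} {c : ℝ}
    (h : ∀ x, e x k = c * x l) : pullbackL1 e (coordL1 k) = (c : ℂ) • coordL1 l := by
  rw [coordL1, coordL1, ← MemLp.toLp_const_smul]
  refine (Lp.toLp_compMeasurePreserving (memLp_coordinate 1 (by norm_num) k)
    ⟨e.continuous.measurable, stdGaussian_map e⟩).trans ?_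
  refine MemLp.toLp_congr _ _ (Eventually.of_forall fun x => ?_)
  simp [h]

variable {κ : Type*} [Fintype κ]

/-- Complex conjugation of the coordinates `x + i y`. -/
def conjugation :
    EuclideanSpace ℝ (κ ⊕ κ) ≃ₗᵢ[ℝ] EuclideanSpace ℝ (κ ⊕ κ) :=
  LinearIsometryEquiv.piLpCongrRight 2 fun k =>
    if k.isRight then LinearIsometryEquiv.neg ℝ else LinearIsometryEquiv.refl ℝ ℝ

/-- The isometry `(x, y) ↦ (y, x)`. -/
def coordinateSwap :
    EuclideanSpace ℝ (κ ⊕ κ) ≃ₗᵢ[ℝ] EuclideanSpace ℝ (κ ⊕ κ) :=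
  LinearIsometryEquiv.piLpCongrLeft 2 ℝ ℝ (Equiv.sumComm κ κ)

theorem pullbackL1_conjugation_inl (n : κ) :
    pullbackL1 conjugation (coordL1 (Sum.inl n : κ ⊕ κ)) = coordL1 (Sum.inl n) := by
  rw [pullbackL1_coordL1 (l := Sum.inl n) (c := 1) fun x => by simp [conjugation]]
  simp

theorem pullbackL1_conjugation_inr (n : κ) :
    pullbackL1 conjugation (coordL1 (Sum.inr n : κ ⊕ κ)) = -coordL1 (Sum.inr n) := by
  rw [pullbackL1_coordL1 (l := Sum.inr n) (c := -1) fun x => by simp [conjugation]]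
  simp

theorem pullbackL1_coordinateSwap_inl (n : κ) :
    pullbackL1 coordinateSwap (coordL1 (Sum.inl n : κ ⊕ κ)) = coordL1 (Sum.inr n) := by
  rw [pullbackL1_coordL1 (l := Sum.inr n) (c := 1) fun x => by
    simp [coordinateSwap, LinearIsometryEquiv.piLpCongrLeft_apply]]
  simp

theorem pullbackL1_coordinateSwap_inr (n : κ) :
    pullbackL1 coordinateSwap (coordL1 (Sum.inr n : κ ⊕ κ)) = coordL1 (Sum.inl n) := by
  rw [pullbackL1_coordL1 (l := Sum.inl n) (c := 1) fun x => by
    simp [coordinateSwap, LinearIsometryEquiv.piLpCongrLeft_apply]]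
  simp

variable (κ) in
/-- The contraction of `L¹(γ)` which maps `x` to `(x + i y) / 2` and `y` to `(y - i x) / 2`. -/
def holomorphicPart : Lp ℂ 1 (stdGaussian (EuclideanSpace ℝ (κ ⊕ κ))) →L[ℂ]
    Lp ℂ 1 (stdGaussian (EuclideanSpace ℝ (κ ⊕ κ))) :=
  (1 / 2 : ℂ) • (ContinuousLinearMap.id ℂ _ + Complex.I •
    ((pullbackL1 coordinateSwap).toContinuousLinearMap.comp
      (pullbackL1 conjugation).toContinuousLinearMap))

theorem norm_holomorphicPart_le : ‖holomorphicPart κ‖ ≤ 1 := by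
  refine ContinuousLinearMap.opNorm_le_bound _ zero_le_one fun f => ?_
  simp only [holomorphicPart, _root_.smul_apply, _root_.add_apply,
    ContinuousLinearMap.id_apply, ContinuousLinearMap.comp_apply,
    LinearIsometry.coe_toContinuousLinearMap]
  rw [norm_smul]
  have h := norm_add_le f (Complex.I • pullbackL1 coordinateSwap (pullbackL1 conjugation f))
  rw [norm_smul, Complex.norm_I, one_mul, LinearIsometry.norm_map, LinearIsometry.norm_map] at h
  have h2 : ‖(1 / 2 : ℂ)‖ = 1 / 2 := by simp
  rw [h2]
  linarith

theorem holomorphicPart_inl (n : κ) : holomorphicPart κ (coordL1 (Sum.inl n)) =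
    (1 / 2 : ℂ) • (coordL1 (Sum.inl n) + Complex.I • coordL1 (Sum.inr n)) := by
  simp [holomorphicPart, pullbackL1_conjugation_inl, pullbackL1_coordinateSwap_inl]

theorem holomorphicPart_inr (n : κ) : holomorphicPart κ (coordL1 (Sum.inr n)) =
    (-Complex.I / 2 : ℂ) • (coordL1 (Sum.inl n) + Complex.I • coordL1 (Sum.inr n)) := by
  simp only [holomorphicPart, _root_.smul_apply, _root_.add_apply,
    ContinuousLinearMap.id_apply, ContinuousLinearMap.comp_apply,
    LinearIsometry.coe_toContinuousLinearMap, pullbackL1_conjugation_inr, map_neg,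
    pullbackL1_coordinateSwap_inr, smul_add, smul_neg, smul_smul]
  rw [show -Complex.I / 2 * Complex.I = 1 / 2 by
    linear_combination (-1 / 2 : ℂ) * Complex.I_sq]
  module

/-- With `z = x + i y`, the pair `x, y` contributes `(z/2) ⊗ x + (-i z/2) ⊗ (-y) = z ⊗ z / 2`.
Without the conjugation in the second factor it would be `z ⊗ (x - i y) / 2`. -/
theorem sum_holomorphicPart_tmul {u₁ : Lp ℂ 1 (stdGaussian (EuclideanSpace ℝ (κ ⊕ κ))) →L[ℂ]
      Lp ℂ 1 m₁} {u₂ : Lp ℂ 1 (stdGaussian (EuclideanSpace ℝ (κ ⊕ κ))) →L[ℂ] Lp ℂ 1 m₂} :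
    ∑ k, u₁ (holomorphicPart κ (coordL1 k)) ⊗ₜ[ℂ] u₂ (pullbackL1 conjugation (coordL1 k)) =
      ∑ n : κ, u₁ (((Real.sqrt 2)⁻¹ : ℂ) •
          (coordL1 (Sum.inl n) + Complex.I • coordL1 (Sum.inr n))) ⊗ₜ[ℂ]
        u₂ (((Real.sqrt 2)⁻¹ : ℂ) •
          (coordL1 (Sum.inl n) + Complex.I • coordL1 (Sum.inr n))) := by
  rw [Fintype.sum_sum_type, ← sum_add_distrib]
  refine sum_congr rfl fun n _ => ?_
  have h2 : ((Real.sqrt 2)⁻¹ : ℂ) * ((Real.sqrt 2)⁻¹ : ℂ) = 1 / 2 := by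
    rw [← mul_inv, ← Complex.ofReal_mul, Real.mul_self_sqrt (by norm_num)]
    simp
  rw [holomorphicPart_inl, holomorphicPart_inr, pullbackL1_conjugation_inl,
    pullbackL1_conjugation_inr]
  set ζ := coordL1 (Sum.inl n : κ ⊕ κ) + Complex.I • coordL1 (Sum.inr n) with hζ
  have hu : u₂ ζ = u₂ (coordL1 (Sum.inl n)) + Complex.I • u₂ (coordL1 (Sum.inr n)) := by
    rw [hζ, map_add, map_smul]
  simp only [map_smul, map_neg, ← TensorProduct.smul_tmul', TensorProduct.tmul_smul, smul_smul, h2,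
    TensorProduct.tmul_neg]
  rw [hu, TensorProduct.tmul_add, TensorProduct.tmul_smul]
  module

theorem IsComplexGaussianFamily.exists_operator [IsProbabilityMeasure P] {N : ℕ} {g : ℕ → Ω → ℂ}
    (hg : IsComplexGaussianFamily g P) :
    ∃ Γ : Lp ℂ 1 (stdGaussian (EuclideanSpace ℝ (Fin N ⊕ Fin N))) →L[ℂ] Lp ℂ 1 P, ‖Γ‖ ≤ 1 ∧
      ∀ n : Fin N, Γ (((Real.sqrt 2)⁻¹ : ℂ) •
        (coordL1 (Sum.inl n) + Complex.I • coordL1 (Sum.inr n))) = hg.toL1 n := by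
  obtain ⟨g', g'', h, hn⟩ := id hg
  have h' := h.precomp (e := Sum.map (Fin.val : Fin N → ℕ) (Fin.val : Fin N → ℕ))
    (Fin.val_injective.sumMap Fin.val_injective)
  obtain ⟨Γ, hΓ, hΓe⟩ := h'.exists_operator
  refine ⟨Γ, hΓ, fun n => ?_⟩
  rw [map_smul, map_add, map_smul, hΓe, hΓe]
  simp only [IsRealGaussianFamily.toL1, IsComplexGaussianFamily.toL1]
  rw [← MemLp.toLp_const_smul, ← MemLp.toLp_add, ← MemLp.toLp_const_smul]
  refine MemLp.toLp_congr _ _ (Eventually.of_forall fun ω => ?_)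
  simp [hn]

end Transfer

end SidonTensor

end

/-! ### The theorem for both kinds of Gaussian sequences -/

theorem mainTheorem2 :
    ∃ w : ℝ → ℝ,
      (∀ δ : ℝ, 0 < δ → δ < 1 → 0 < w δ) ∧
      (w =O[𝓝[>] (0 : ℝ)] fun δ => Real.log (1 / δ)) ∧
      ∀ (Ω : Type*) [MeasurableSpace Ω] (P : Measure Ω) [IsProbabilityMeasure P]
        (T₁ : Type*) [MeasurableSpace T₁] (m₁ : Measure T₁) [IsProbabilityMeasure m₁]
        (T₂ : Type*) [MeasurableSpace T₂] (m₂ : Measure T₂) [IsProbabilityMeasure m₂],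
        (∀ (g : ℕ → Ω → ℂ) (hg : SidonTensor.IsComplexGaussianFamily g P)
          (δ : ℝ), 0 < δ → δ < 1 →
          ∀ (N : ℕ) (φ₁ : Fin N → Lp ℂ 1 m₁) (φ₂ : Fin N → Lp ℂ 1 m₂),
            SidonTensor.IsDominated 1 (fun n : Fin N => hg.toL1 (n : ℕ)) φ₁ →
            SidonTensor.IsDominated 1 (fun n : Fin N => hg.toL1 (n : ℕ)) φ₂ →
            ∃ t r : Lp ℂ 1 m₁ ⊗[ℂ] Lp ℂ 1 m₂,
              ∑ n, φ₁ n ⊗ₜ[ℂ] φ₂ n = t + r ∧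
              SidonTensor.projectiveNorm t ≤ w δ ∧
              SidonTensor.injectiveNorm r ≤ δ) ∧
        (∀ (g : ℕ → Ω → ℝ) (hg : SidonTensor.IsRealGaussianFamily g P)
          (δ : ℝ), 0 < δ → δ < 1 →
          ∀ (N : ℕ) (φ₁ : Fin N → Lp ℂ 1 m₁) (φ₂ : Fin N → Lp ℂ 1 m₂),
            SidonTensor.IsDominated 1 (fun n : Fin N => hg.toL1 (n : ℕ)) φ₁ →
            SidonTensor.IsDominated 1 (fun n : Fin N => hg.toL1 (n : ℕ)) φ₂ →
            ∃ t r : Lp ℂ 1 m₁ ⊗[ℂ] Lp ℂ 1 m₂,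
              ∑ n, φ₁ n ⊗ₜ[ℂ] φ₂ n = t + r ∧
              SidonTensor.projectiveNorm t ≤ w δ ∧
              SidonTensor.injectiveNorm r ≤ δ) := by
  refine ⟨SidonTensor.massBound, fun δ _ _ => SidonTensor.massBound_pos δ,
    SidonTensor.massBound_isBigO, ?_⟩
  intro Ω _ P _ T₁ _ m₁ _ T₂ _ m₂ _
  constructor
  · rintro g hg δ h0 h1 N φ₁ φ₂ ⟨u₁, hu₁, hφ₁⟩ ⟨u₂, hu₂, hφ₂⟩
    obtain ⟨Γ, hΓ, hΓe⟩ := hg.exists_operator (N := N)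
    -- The two factors receive different contractions, so the real decomposition on `Fin N ⊕ Fin N`
    -- applies with the same bound and no loss of constant.
    have hc₁ : ‖(u₁.comp Γ).comp (SidonTensor.holomorphicPart (Fin N))‖ ≤ 1 :=
      (ContinuousLinearMap.opNorm_comp_le _ _).trans (mul_le_one₀
        ((u₁.opNorm_comp_le Γ).trans (mul_le_one₀ hu₁ (norm_nonneg _) hΓ)) (norm_nonneg _)
        SidonTensor.norm_holomorphicPart_le)
    have hc₂ : ‖(u₂.comp Γ).comp (SidonTensor.pullbackL1
        (SidonTensor.conjugation (κ := Fin N))).toContinuousLinearMap‖ ≤ 1 :=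
      (ContinuousLinearMap.opNorm_comp_le _ _).trans (mul_le_one₀
        ((u₂.opNorm_comp_le Γ).trans (mul_le_one₀ hu₂ (norm_nonneg _) hΓ)) (norm_nonneg _)
        (LinearIsometry.norm_toContinuousLinearMap_le _))
    obtain ⟨t, r, htr, ht, hr⟩ := SidonTensor.exists_decomposition_of_operators h0 h1 hc₁ hc₂
    refine ⟨t, r, ?_, ht, hr⟩
    rw [← htr]
    refine Eq.trans ?_ (SidonTensor.sum_holomorphicPart_tmul (κ := Fin N) (u₁ := u₁.comp Γ)
      (u₂ := u₂.comp Γ)).symm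
    refine Finset.sum_congr rfl fun n _ => ?_
    rw [ContinuousLinearMap.comp_apply, ContinuousLinearMap.comp_apply, hΓe, hφ₁, hφ₂]
  · rintro g hg δ h0 h1 N φ₁ φ₂ ⟨u₁, hu₁, hφ₁⟩ ⟨u₂, hu₂, hφ₂⟩
    obtain ⟨Γ, hΓ, hΓe⟩ := (hg.precomp (Fin.val_injective (n := N))).exists_operator
    obtain ⟨t, r, htr, ht, hr⟩ := SidonTensor.exists_decomposition_of_operators h0 h1
      ((u₁.opNorm_comp_le Γ).trans (mul_le_one₀ hu₁ (norm_nonneg _) hΓ))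
      ((u₂.opNorm_comp_le Γ).trans (mul_le_one₀ hu₂ (norm_nonneg _) hΓ))
    refine ⟨t, r, ?_, ht, hr⟩
    rw [← htr]
    refine Finset.sum_congr rfl fun n _ => ?_
    rw [ContinuousLinearMap.comp_apply, ContinuousLinearMap.comp_apply, hΓe, ← hφ₁, ← hφ₂]
    rfl
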